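/- **Theorem (Multiplier process).** For a real random variable $Y$ put $\|Y\|_{\psi_2}:=\inf\{c>0:\mathbb E[e^{Y^2/c^2}-1]\le 1\}\in[0,\infty]$. There exist universal constants $c,C>0$ such that the following holds. Let $(B,\mathcal B,\mathbf P)$ be a probability space and let $(\xi,X)$ be a random pair with values in $\mathbb R\times B$, with $\xi$ and $X$ possibly dependent, such that $X$ has law $\mathbf P$ and $\|\xi\|_{\psi_2}<\infty$. Let $n\ge 1$ and let $(\xi_1,X_1),\dots,(\xi_n,X_n)$ be iid copies of $(\xi,X)$. Let $F$ be a class of measurable functions $f:B\to\mathbb R$ with $\|f\|_{\psi_2}:=\|f(X)\|_{\psi_2}<\infty$, and for $f\in F$ define the multiplier process $$M(f):=\frac1n\sum_{i=1}^n\bigl(\xi_i f(X_i)-\mathbb E[\xi f(X)]\bigr).$$ Assume that $(M(f))_{f\in F}$ is separable: there is a countable set $D\subseteq F$ such that, almost surely, $M(f)$ lies in the closure of $\{M(g):g\in D\}$ for every $f\in F$ (this holds for instance if $F$ is countable). Then for all $f_0\in F$, $u\ge1$ and $v\ge 1$, with probability at least $1-ce^{-u/4}-ce^{-nv}$, $$\sup_{f\in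 F}|M(f)-M(f_0)|\le C\left[(\sqrt v+1)\,\|\xi\|_{\psi_2}\frac{\gamma_2(F)}{\sqrt n}+\left(\sqrt{\frac{2u}{n}}+\frac un+\sqrt{\frac{uv}{n}}\right)\|\xi\|_{\psi_2}\,\bar\Delta(F)\right].$$ Here $\mathsf d(f,g):=\|f-g\|_{\psi_2}$, $\bar\Delta(F):=\sup_{f\in F}\mathsf d(f,0)$, and $$\gamma_2(F):=\inf_{(F_k)}\ \sup_{f\in F}\ \sum_{k\ge 0}2^{k/2}\,\mathsf d(f,F_k),$$ where the infimum runs over all sequences $(F_k)_{k\ge0}$ of subsets of $F$ with $|F_0|=1$, $|F_k|\le 2^{2^k}$ for all $k$, and $\bigcup_k F_k$ dense in $F$ with respect to $\mathsf d$. These quantities may be infinite, in which case $0\cdot\infty:=0$. -/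

import Mathlib

open MeasureTheory ProbabilityTheory Set
open scoped ENNReal NNReal

namespace MultProc

noncomputable section

/-- The Young function `ψ₂(t) = exp(t²) - 1`. -/
def psi2 (t : ℝ) : ℝ := Real.exp (t ^ 2) - 1

/-- The `ψ₂`-Orlicz norm `inf {c > 0 : E[ψ₂(Y / c)] ≤ 1}` of a random variable `Y`, with values in
`[0, ∞]` (the infimum of the empty set is `∞`). -/
def psi2Norm {Ω : Type*} [MeasurableSpace Ω] (μ : Measure Ω) (Y : Ω → ℝ) : ℝ≥0∞ :=
  ⨅ (c : ℝ≥0) (_ : 0 < c) (_ : ∫⁻ ω, ENNReal.ofReal (psi2 (Y ω / c)) ∂μ ≤ 1), (c : ℝ≥0∞)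

/-- The family `L_{ψ₂}(P)` of measurable functions with finite `ψ₂`-norm. -/
def Lpsi2 {B : Type*} [MeasurableSpace B] (P : Measure B) : Set (B → ℝ) :=
  {f | Measurable f ∧ psi2Norm P f < ∞}

/-- The pseudo-distance `d(f, g) = ‖f - g‖_{ψ₂}`. -/
def psi2Dist {B : Type*} [MeasurableSpace B] (P : Measure B) (f g : B → ℝ) : ℝ≥0∞ :=
  psi2Norm P (fun x => f x - g x)

/-- The distance from a point to a set (it is `∞` if the set is empty). -/
def distTo {T : Type*} (d : T → T → ℝ≥0∞) (t : T) (A : Set T) : ℝ≥0∞ :=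
  ⨅ s ∈ A, d t s

/-- Admissible sequences of subsets of `F` for the pseudo-distance `d`: `|A 0| = 1`,
`|A k| ≤ 2^(2^k)`, and the union of the `A k` is `d`-dense in `F`. -/
structure IsAdmissible {T : Type*} (d : T → T → ℝ≥0∞) (F : Set T) (A : ℕ → Set T) : Prop where
  subset : ∀ k, A k ⊆ F
  card_zero : (A 0).encard = 1
  card_le : ∀ k, (A k).encard ≤ 2 ^ 2 ^ k
  dense : ∀ t ∈ F, ∀ ε : ℝ≥0∞, 0 < ε → ∃ k, ∃ s ∈ A k, d t s < ε

/-- Talagrand's functional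
`γ₂(F, d) = inf_{(A k)} sup_{t ∈ F} ∑_{k ≥ 0} 2^(k/2) d(t, A k)`,
the infimum running over the admissible sequences. -/
def gamma2 {T : Type*} (d : T → T → ℝ≥0∞) (F : Set T) : ℝ≥0∞ :=
  ⨅ (A : ℕ → Set T) (_ : IsAdmissible d F A),
    ⨆ t ∈ F, ∑' k : ℕ, (2 : ℝ≥0∞) ^ ((k : ℝ) / 2) * distTo d t (A k)

/-- `Δ̄(F) = sup_{f ∈ F} d(f, 0)`. -/
def radius {B : Type*} [MeasurableSpace B] (P : Measure B) (F : Set (B → ℝ)) : ℝ≥0∞ :=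
  ⨆ f ∈ F, psi2Dist P f 0

/-- The multiplier process `M(f) = (1/n) ∑_i (ξ_i f(X_i) - E[ξ f(X)])`; the pair `(ξ, X)` lives on
`(Ω₀, ν)`, the sample `(ξ_i, X_i)` on `Ω`. -/
def multM {Ω₀ Ω B : Type*} [MeasurableSpace Ω₀] (ν : Measure Ω₀)
    (ξ : Ω₀ → ℝ) (X : Ω₀ → B) {n : ℕ} (ξs : Fin n → Ω → ℝ) (Xs : Fin n → Ω → B)
    (f : B → ℝ) (ω : Ω) : ℝ :=
  (1 / (n : ℝ)) * ∑ i, (ξs i ω * f (Xs i ω) - ∫ ω₀, ξ ω₀ * f (X ω₀) ∂ν)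

/-- Separability of a real process `(Z f)` indexed by `f ∈ F`: for some countable `D ⊆ F`,
almost surely every value of the process on `F` is a limit of its values on `D`. Every countable
`F` qualifies. -/
def IsSeparableOn {Ω T : Type*} [MeasurableSpace Ω] (μ : Measure Ω)
    (Z : T → Ω → ℝ) (F : Set T) : Prop :=
  ∃ D : Set T, D ⊆ F ∧ D.Countable ∧ ∀ᵐ ω ∂μ, ∀ f ∈ F, Z f ω ∈ closure ((fun g => Z g ω) '' D)

end

end MultProc

/-! A product of two subgaussian variables is only subexponential, so Bernstein's inequality for an
increment `M f - M g` has a tail of order `√(t/n) + t/n`. Chaining with such a tail would also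
require a `γ₁`-type functional, because of the linear term. That term is avoided by conditioning on
the event `G` that `∑ ξᵢ² ≤ 2nv‖ξ‖²` (up to a constant in the scale), whose complement has
probability at most `exp(-nv)`. On `G`, Bernstein is used only for `t ≤ n`, where `t ≤ √(nt)`. For
`t > n`, Cauchy-Schwarz separates the multipliers from `∑ h(Xᵢ)²`, which is at most of order `t‖h‖²`
outside probability `exp(-t)`. Either way the deviation of the unnormalised sum is `√v √(nt)`: this
is `measureReal_sum_mul_deviation_le`, and it makes the increments on `G` subgaussian at all levels.

The chain starts at the level `l` with `2^l` comparable to `u`. Links from level `l` onwards are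
controlled on `G` by a union bound at `t = 8·2^k` and sum to the `γ₂` term. The starting points are
at most `2^(2^l)` in number, and plain Bernstein at `t = 8·2^l` gives the term in `√(u/n) + u/n`
times the radius. The chains converge almost surely for the countably many indices of `D`, and
separability carries the bound to `F`. The result is stronger than claimed: no `√(uv/n)` term is
needed. -/

namespace MultProc

/-! ### Exponential moments and tail bounds for sums of products. -/

/-- `Z` is subexponential at scale `K`: `E exp(|Z| / K) ≤ 2`. -/
structure HasPsi1Bound {Ω : Type*} [MeasurableSpace Ω] (μ : Measure Ω) (Z : Ω → ℝ) (K : ℝ) :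
    Prop where
  meas : AEMeasurable Z μ
  pos : 0 < K
  integrable : Integrable (fun ω => Real.exp (|Z ω| / K)) μ
  le_two : ∫ ω, Real.exp (|Z ω| / K) ∂μ ≤ 2

/-- `Y` is subgaussian at scale `K`: `E exp(Y² / K²) ≤ 2`. -/
structure HasPsi2Bound {Ω : Type*} [MeasurableSpace Ω] (μ : Measure Ω) (Y : Ω → ℝ) (K : ℝ) :
    Prop where
  meas : AEMeasurable Y μ
  pos : 0 < K
  integrable : Integrable (fun ω => Real.exp (Y ω ^ 2 / K ^ 2)) μ
  le_two : ∫ ω, Real.exp (Y ω ^ 2 / K ^ 2) ∂μ ≤ 2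

section

variable {Ω Ω' : Type*} [MeasurableSpace Ω] [MeasurableSpace Ω'] {μ : Measure Ω} {ν : Measure Ω'}

theorem HasPsi2Bound.of_identDistrib {Y : Ω → ℝ} {Y' : Ω' → ℝ} {K : ℝ}
    (h : HasPsi2Bound ν Y' K) (hd : IdentDistrib Y Y' μ ν) : HasPsi2Bound μ Y K := by
  have hd2 : IdentDistrib (fun ω => Real.exp (Y ω ^ 2 / K ^ 2))
      (fun ω => Real.exp (Y' ω ^ 2 / K ^ 2)) μ ν :=
    hd.comp (u := fun y => Real.exp (y ^ 2 / K ^ 2)) (by fun_prop)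
  exact ⟨hd.aemeasurable_fst, h.pos, hd2.integrable_iff.2 h.integrable,
    hd2.integral_eq ▸ h.le_two⟩

theorem HasPsi2Bound.mul {X Y : Ω → ℝ} {A B : ℝ} (hX : HasPsi2Bound μ X A)
    (hY : HasPsi2Bound μ Y B) : HasPsi1Bound μ (fun ω => X ω * Y ω) (A * B) := by
  have hm : AEMeasurable (fun ω => X ω * Y ω) μ := hX.meas.mul hY.meas
  have hle : ∀ ω, Real.exp (|X ω * Y ω| / (A * B)) ≤
      (Real.exp (X ω ^ 2 / A ^ 2) + Real.exp (Y ω ^ 2 / B ^ 2)) / 2 := by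
    intro ω
    have h1 : |X ω * Y ω| / (A * B) = (|X ω| / A) * (|Y ω| / B) := by
      rw [abs_mul]; have := hX.pos; have := hY.pos; field_simp
    have h2 : (|X ω| / A) ^ 2 = X ω ^ 2 / A ^ 2 := by rw [div_pow, sq_abs]
    have h3 : (|Y ω| / B) ^ 2 = Y ω ^ 2 / B ^ 2 := by rw [div_pow, sq_abs]
    rw [h1, ← h2, ← h3]
    set a := |X ω| / A
    set b := |Y ω| / B
    have h4 : Real.exp (a * b) ≤ Real.exp (a ^ 2 / 2) * Real.exp (b ^ 2 / 2) := by
      rw [← Real.exp_add]; gcongr; nlinarith [sq_nonneg (a - b)]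
    have h5 : Real.exp (a ^ 2) = Real.exp (a ^ 2 / 2) ^ 2 := by
      rw [← Real.exp_nat_mul]; congr 1; push_cast; ring
    have h6 : Real.exp (b ^ 2) = Real.exp (b ^ 2 / 2) ^ 2 := by
      rw [← Real.exp_nat_mul]; congr 1; push_cast; ring
    rw [h5, h6]
    nlinarith [sq_nonneg (Real.exp (a ^ 2 / 2) - Real.exp (b ^ 2 / 2))]
  have hi : Integrable (fun ω =>
      (Real.exp (X ω ^ 2 / A ^ 2) + Real.exp (Y ω ^ 2 / B ^ 2)) / 2) μ :=
    (hX.integrable.add hY.integrable).div_const 2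
  have hi' : Integrable (fun ω => Real.exp (|X ω * Y ω| / (A * B))) μ := by
    refine hi.mono' (AEMeasurable.aestronglyMeasurable ?_) (ae_of_all _ fun ω => ?_)
    · exact Real.measurable_exp.comp_aemeasurable ((hm.abs).div_const _)
    · rw [Real.norm_of_nonneg (Real.exp_pos _).le]; exact hle ω
  refine ⟨hm, mul_pos hX.pos hY.pos, hi', (integral_mono hi' hi hle).trans ?_⟩
  rw [integral_div, integral_add hX.integrable hY.integrable]
  linarith [hX.le_two, hY.le_two]

theorem HasPsi1Bound.integrable_self {Z : Ω → ℝ} {K : ℝ} (h : HasPsi1Bound μ Z K) :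
    Integrable Z μ := by
  refine (h.integrable.const_mul K).mono' h.meas.aestronglyMeasurable (ae_of_all _ fun ω => ?_)
  have := Real.add_one_le_exp (|Z ω| / K)
  rw [Real.norm_eq_abs]
  calc |Z ω| = K * (|Z ω| / K) := by have := h.pos; field_simp
    _ ≤ _ := by have := h.pos; gcongr; linarith

theorem HasPsi1Bound.integral_abs_le [IsProbabilityMeasure μ] {Z : Ω → ℝ} {K : ℝ}
    (h : HasPsi1Bound μ Z K) : ∫ ω, |Z ω| ∂μ ≤ K := by
  have hK := h.pos
  have h1 : ∫ ω, |Z ω| ∂μ ≤ ∫ ω, K * (Real.exp (|Z ω| / K) - 1) ∂μ := by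
    refine integral_mono h.integrable_self.abs
      ((h.integrable.sub (integrable_const 1)).const_mul K) fun ω => ?_
    have := Real.add_one_le_exp (|Z ω| / K)
    calc |Z ω| = K * (|Z ω| / K) := by field_simp
      _ ≤ _ := by gcongr; linarith
  rw [integral_const_mul, integral_sub h.integrable (integrable_const 1)] at h1
  simp only [integral_const, probReal_univ, smul_eq_mul, mul_one] at h1
  nlinarith [h.le_two]

/-- The second-order Taylor remainder is at most `(lz)² exp|lz|`. Half of the exponent `|z|` pays
for `exp|lz|`, and the other half absorbs `z² ≤ 8 exp(|z|/2)`. -/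
theorem exp_mul_le_of_abs_le_half {z l : ℝ} (hl : |l| ≤ 1 / 2) :
    Real.exp (l * z) ≤ 1 + l * z + 8 * l ^ 2 * Real.exp |z| := by
  have h1 := Complex.norm_exp_sub_sum_le_norm_mul_exp ((l * z : ℝ) : ℂ) 2
  have h2 : |Real.exp (l * z) - (1 + l * z)| ≤ |l * z| ^ 2 * Real.exp |l * z| := by
    have e : Complex.exp ((l * z : ℝ) : ℂ) - ∑ m ∈ Finset.range 2, ((l * z : ℝ) : ℂ) ^ m / m.factorial
        = ((Real.exp (l * z) - (1 + l * z) : ℝ) : ℂ) := by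
      simp [Finset.sum_range_succ]
    rw [e, Complex.norm_real, Complex.norm_real] at h1
    exact h1
  have h3 : Real.exp |l * z| ≤ Real.exp (|z| / 2) := by
    rw [abs_mul]; gcongr; nlinarith [abs_nonneg z]
  have h4 : |z| ^ 2 ≤ 8 * Real.exp (|z| / 2) := by
    have := Real.quadratic_le_exp_of_nonneg (x := |z| / 2) (by positivity)
    nlinarith [abs_nonneg z]
  have h5 : Real.exp |z| = Real.exp (|z| / 2) * Real.exp (|z| / 2) := by
    rw [← Real.exp_add]; congr 1; ring
  have h6 : |l * z| ^ 2 * Real.exp |l * z| ≤ 8 * l ^ 2 * Real.exp |z| := by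
    rw [h5, abs_mul, mul_pow, sq_abs]
    calc l ^ 2 * |z| ^ 2 * Real.exp (|l| * |z|)
        ≤ l ^ 2 * (8 * Real.exp (|z| / 2)) * Real.exp (|z| / 2) := by
          rw [← abs_mul]; gcongr
      _ = _ := by ring
  linarith [le_abs_self (Real.exp (l * z) - (1 + l * z))]

theorem HasPsi1Bound.mgf_sub_mean_le [IsProbabilityMeasure μ] {Z : Ω → ℝ} {K : ℝ}
    (h : HasPsi1Bound μ Z K) {l : ℝ} (hl : |l| * K ≤ 1 / 2) :
    Integrable (fun ω => Real.exp (l * (Z ω - ∫ ω', Z ω' ∂μ))) μ ∧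
      mgf (fun ω => Z ω - ∫ ω', Z ω' ∂μ) μ l ≤ Real.exp (16 * (l * K) ^ 2) := by
  have hK := h.pos
  set m := ∫ ω', Z ω' ∂μ with hm
  have hle : ∀ ω, Real.exp (l * Z ω) ≤
      1 + l * Z ω + 8 * (l * K) ^ 2 * Real.exp (|Z ω| / K) := by
    intro ω
    have h1 := exp_mul_le_of_abs_le_half (z := Z ω / K) (l := l * K)
      (by rwa [abs_mul, abs_of_pos hK])
    have h2 : l * K * (Z ω / K) = l * Z ω := by field_simp
    rwa [h2, abs_div, abs_of_pos hK] at h1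
  have hi : Integrable (fun ω => 1 + l * Z ω + 8 * (l * K) ^ 2 * Real.exp (|Z ω| / K)) μ :=
    ((integrable_const 1).add (h.integrable_self.const_mul l)).add (h.integrable.const_mul _)
  have hi' : Integrable (fun ω => Real.exp (l * Z ω)) μ := by
    refine hi.mono' (AEMeasurable.aestronglyMeasurable ?_) (ae_of_all _ fun ω => ?_)
    · exact Real.measurable_exp.comp_aemeasurable (h.meas.const_mul _)
    · rw [Real.norm_of_nonneg (Real.exp_pos _).le]; exact hle ω
  have he : ∀ ω, Real.exp (l * (Z ω - m)) = Real.exp (-(l * m)) * Real.exp (l * Z ω) := by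
    intro ω; rw [← Real.exp_add]; congr 1; ring
  refine ⟨by simpa only [he] using hi'.const_mul _, ?_⟩
  have h3 : ∫ ω, Real.exp (l * Z ω) ∂μ ≤ 1 + l * m + 16 * (l * K) ^ 2 := by
    refine (integral_mono hi' hi hle).trans ?_
    rw [integral_add (f := fun ω => 1 + l * Z ω)
      ((integrable_const 1).add (h.integrable_self.const_mul l))
      (h.integrable.const_mul _), integral_add (integrable_const 1)
      (h.integrable_self.const_mul l), integral_const_mul, integral_const_mul]
    simp only [integral_const, probReal_univ, smul_eq_mul, mul_one]
    nlinarith [h.le_two, sq_nonneg (l * K)]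
  have h4 : 1 + l * m + 16 * (l * K) ^ 2 ≤ Real.exp (l * m + 16 * (l * K) ^ 2) := by
    linarith [Real.add_one_le_exp (l * m + 16 * (l * K) ^ 2)]
  simp only [mgf, he]
  rw [integral_const_mul]
  calc _ ≤ Real.exp (-(l * m)) * Real.exp (l * m + 16 * (l * K) ^ 2) := by
        gcongr; exact h3.trans h4
    _ = _ := by rw [← Real.exp_add]; congr 1; ring

theorem measureReal_sum_ge_le_of_mgf_le [IsProbabilityMeasure μ] {n : ℕ} (hn : 1 ≤ n)
    {W : Fin n → Ω → ℝ} {K : ℝ} (hK : 0 < K) (hW : ∀ i, Measurable (W i)) (hind : iIndepFun W μ)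
    (hmgf : ∀ i, ∀ l : ℝ, |l| * K ≤ 1 / 2 → Integrable (fun ω => Real.exp (l * W i ω)) μ ∧
      mgf (W i) μ l ≤ Real.exp (16 * (l * K) ^ 2)) {t : ℝ} (ht : 0 ≤ t) :
    μ.real {ω | 10 * K * (√(n * t) + t) ≤ ∑ i, W i ω} ≤ Real.exp (-t) := by
  -- Chernoff's bound with the scale-free parameter `a = l K`; it remains to choose `a` in the two
  -- regimes.
  have key : ∀ a : ℝ, 0 ≤ a → a ≤ 1 / 2 →
      16 * n * a ^ 2 + t ≤ a * (10 * (√(n * t) + t)) →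
      μ.real {ω | 10 * K * (√(n * t) + t) ≤ ∑ i, W i ω} ≤ Real.exp (-t) := by
    intro a ha ha2 hat
    have hl : |a / K| * K ≤ 1 / 2 := by
      rw [abs_of_nonneg (by positivity)]; field_simp; linarith
    have hint : Integrable (fun ω => Real.exp (a / K * (∑ i, W i) ω)) μ :=
      hind.integrable_exp_mul_sum (s := Finset.univ) hW fun i _ => (hmgf i _ hl).1
    have h1 := measure_ge_le_exp_mul_mgf (μ := μ) (X := ∑ i, W i)
      (10 * K * (√(n * t) + t)) (t := a / K) (by positivity) hint
    rw [hind.mgf_sum hW] at h1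
    have h2 : ∏ i, mgf (W i) μ (a / K) ≤ ∏ _i : Fin n, Real.exp (16 * a ^ 2) := by
      refine Finset.prod_le_prod (fun i _ => mgf_nonneg) fun i _ => ?_
      have := (hmgf i _ hl).2
      rwa [div_mul_cancel₀ _ hK.ne'] at this
    rw [Finset.prod_const, Finset.card_univ, Fintype.card_fin, ← Real.exp_nat_mul] at h2
    simp only [Finset.sum_apply] at h1
    calc _ ≤ _ := h1
      _ ≤ Real.exp (-(a / K) * (10 * K * (√(n * t) + t))) * Real.exp (n * (16 * a ^ 2)) := by
          gcongr
      _ ≤ Real.exp (-t) := by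
          rw [← Real.exp_add]
          gcongr
          have : -(a / K) * (10 * K * (√(n * t) + t)) = - (a * (10 * (√(n * t) + t))) := by
            field_simp
          rw [this]; linarith
  have hn0 : (0 : ℝ) < n := by exact_mod_cast hn
  rcases le_total t n with htn | htn
  · have hs : √(t / n) ≤ 1 := Real.sqrt_le_one.2 ((div_le_one hn0).2 htn)
    have h1 : √(t / n) * √(n * t) = t := by
      rw [← Real.sqrt_mul (by positivity), show t / n * (n * t) = t * t by field_simp,
        Real.sqrt_mul_self ht]
    have h2 : √(t / n) ^ 2 * n = t := by
      rw [Real.sq_sqrt (by positivity)]; field_simp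
    -- Here `16 n a² + t = 5t`, exactly what `10 a √(nt)` supplies.
    refine key (√(t / n) / 2) (by positivity) (by linarith) ?_
    nlinarith [mul_nonneg (Real.sqrt_nonneg (t / n)) ht]
  · refine key (1 / 2) (by norm_num) le_rfl ?_
    nlinarith [Real.sqrt_nonneg (n * t)]

/-- Bernstein's inequality for independent subexponential variables. -/
theorem measureReal_abs_sum_sub_mean_ge_le [IsProbabilityMeasure μ] {n : ℕ} (hn : 1 ≤ n)
    {Z : Fin n → Ω → ℝ} {K m : ℝ} (hm : ∀ i, Measurable (Z i)) (hind : iIndepFun Z μ)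
    (hZ : ∀ i, HasPsi1Bound μ (Z i) K) (hmean : ∀ i, ∫ ω, Z i ω ∂μ = m) {t : ℝ} (ht : 0 ≤ t) :
    μ.real {ω | 10 * K * (√(n * t) + t) ≤ |∑ i, (Z i ω - m)|} ≤ 2 * Real.exp (-t) := by
  have hK : 0 < K := (hZ ⟨0, hn⟩).pos
  have hmgf : ∀ i, ∀ l : ℝ, |l| * K ≤ 1 / 2 →
      Integrable (fun ω => Real.exp (l * (Z i ω - m))) μ ∧
        mgf (fun ω => Z i ω - m) μ l ≤ Real.exp (16 * (l * K) ^ 2) := by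
    intro i l hl
    have := (hZ i).mgf_sub_mean_le hl
    rwa [hmean i] at this
  have h1 := measureReal_sum_ge_le_of_mgf_le hn hK (W := fun i ω => Z i ω - m)
    (fun i => (hm i).sub_const m) (hind.comp (fun _ z => z - m) fun _ => by fun_prop) hmgf ht
  have h2 := measureReal_sum_ge_le_of_mgf_le hn hK (W := fun i ω => -(Z i ω - m))
    (fun i => ((hm i).sub_const m).neg) (hind.comp (fun _ z => -(z - m)) fun _ => by fun_prop)
    (fun i l hl => by
      have := hmgf i (-l) (by rwa [abs_neg])
      refine ⟨by simpa only [neg_mul, mul_neg] using this.1, ?_⟩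
      have h3 := this.2
      simp only [mgf, neg_mul, even_two.neg_pow] at h3 ⊢
      simpa only [mul_neg] using h3) ht
  have hsub : {ω | 10 * K * (√(n * t) + t) ≤ |∑ i, (Z i ω - m)|} ⊆
      {ω | 10 * K * (√(n * t) + t) ≤ ∑ i, (Z i ω - m)} ∪
        {ω | 10 * K * (√(n * t) + t) ≤ ∑ i, -(Z i ω - m)} := by
    intro ω hω
    simp only [mem_ofPred_eq, mem_union, Finset.sum_neg_distrib] at hω ⊢
    exact le_abs.1 hω
  calc _ ≤ _ := measureReal_mono hsub
    _ ≤ _ := measureReal_union_le _ _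
    _ ≤ _ := by linarith

/-- Chernoff at exponent `1`: each factor `E exp(Yᵢ²/K²) ≤ 2 ≤ e`, so the product costs `exp n`,
which the shift of the level by `n` cancels. -/
theorem measureReal_sum_sq_ge_le [IsProbabilityMeasure μ] {n : ℕ}
    {Y : Fin n → Ω → ℝ} {K : ℝ} (hK : 0 < K) (hm : ∀ i, Measurable (Y i)) (hind : iIndepFun Y μ)
    (hY : ∀ i, HasPsi2Bound μ (Y i) K) (t : ℝ) :
    μ.real {ω | (n + t) * K ^ 2 ≤ ∑ i, Y i ω ^ 2} ≤ Real.exp (-t) := by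
  have hind' : iIndepFun (fun i ω => Y i ω ^ 2 / K ^ 2) μ :=
    hind.comp (fun _ z => z ^ 2 / K ^ 2) fun _ => by fun_prop
  have hm' : ∀ i, Measurable fun ω => Y i ω ^ 2 / K ^ 2 := fun i => by
    have := hm i; fun_prop
  have hint := hind'.integrable_exp_mul_sum (s := Finset.univ) (t := 1) hm' fun i _ => by
    simpa using (hY i).integrable
  have h1 := measure_ge_le_exp_mul_mgf (n + t) (t := 1) zero_le_one hint
  rw [hind'.mgf_sum hm'] at h1
  have h2 : ∏ i, mgf (fun ω => Y i ω ^ 2 / K ^ 2) μ 1 ≤ ∏ _i : Fin n, Real.exp 1 := by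
    refine Finset.prod_le_prod (fun i _ => mgf_nonneg) fun i _ => ?_
    have := (hY i).le_two
    have := Real.add_one_le_exp 1
    simp only [mgf, one_mul]
    linarith
  rw [Finset.prod_const, Finset.card_univ, Fintype.card_fin, ← Real.exp_nat_mul] at h2
  have hset : {ω | (n + t) * K ^ 2 ≤ ∑ i, Y i ω ^ 2} =
      {ω | n + t ≤ (∑ i, fun ω => Y i ω ^ 2 / K ^ 2) ω} := by
    ext ω
    simp only [mem_ofPred_eq, Finset.sum_apply, ← Finset.sum_div]
    rw [le_div_iff₀ (by positivity)]
  rw [hset]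
  calc _ ≤ _ := h1
    _ ≤ Real.exp (-1 * (n + t)) * Real.exp (n * 1) := by gcongr
    _ = Real.exp (-t) := by rw [← Real.exp_add]; congr 1; ring

/-- Deviation of a sum of products `ξᵢ hᵢ` at a level `t`, on the event that the empirical second
moment of the multipliers is under control. For `t ≤ n` this is Bernstein's inequality, for `t > n`
the Cauchy-Schwarz inequality. -/
theorem measureReal_sum_mul_deviation_le [IsProbabilityMeasure μ] {n : ℕ} (hn : 1 ≤ n)
    {ξs hs : Fin n → Ω → ℝ} {A B m v : ℝ} (hv : 1 ≤ v) (hξm : ∀ i, Measurable (ξs i))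
    (hhm : ∀ i, Measurable (hs i)) (hind : iIndepFun (fun i ω => ξs i ω * hs i ω) μ)
    (hindh : iIndepFun hs μ) (hξ : ∀ i, HasPsi2Bound μ (ξs i) A)
    (hh : ∀ i, HasPsi2Bound μ (hs i) B) (hmean : ∀ i, ∫ ω, ξs i ω * hs i ω ∂μ = m)
    {t : ℝ} (ht : 0 ≤ t) :
    μ.real {ω | ∑ i, ξs i ω ^ 2 ≤ 2 * n * v * A ^ 2 ∧
      20 * √v * √(n * t) * (A * B) < |∑ i, (ξs i ω * hs i ω - m)|} ≤ 2 * Real.exp (-t) := by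
  have hA : 0 < A := (hξ ⟨0, hn⟩).pos
  have hB : 0 < B := (hh ⟨0, hn⟩).pos
  have hAB : 0 < A * B := mul_pos hA hB
  have hn0 : (0 : ℝ) < n := by exact_mod_cast hn
  have hv1 : 1 ≤ √v := Real.one_le_sqrt.2 hv
  rcases le_total t n with htn | htn
  · refine (measureReal_mono ?_).trans (measureReal_abs_sum_sub_mean_ge_le hn
      (fun i => (hξm i).mul (hhm i)) hind (fun i => (hξ i).mul (hh i)) hmean ht)
    rintro ω ⟨-, hω⟩
    have h1 : t ≤ √(n * t) := Real.le_sqrt_of_sq_le (by nlinarith)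
    refine le_trans ?_ hω.le
    calc 10 * (A * B) * (√(n * t) + t) ≤ 10 * (A * B) * (√(n * t) + √(n * t)) := by gcongr
      _ = 20 * 1 * √(n * t) * (A * B) := by ring
      _ ≤ _ := by gcongr
  · have h0 := measureReal_sum_sq_ge_le hB hhm hindh hh t
    refine (measureReal_mono ?_).trans (h0.trans (by linarith [Real.exp_pos (-t)]))
    rintro ω ⟨hG, hω⟩
    by_contra hcon
    simp only [mem_ofPred_eq, not_le] at hcon
    refine hω.not_ge ?_
    have hm1 : |m| ≤ A * B := by
      have h1 := ((hξ ⟨0, hn⟩).mul (hh ⟨0, hn⟩)).integral_abs_le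
      rw [← hmean ⟨0, hn⟩]
      exact abs_integral_le_integral_abs.trans h1
    -- In this regime no cancellation from centring is needed: the total mean, at most `n A B`, is
    -- itself below `√(nt) A B`.
    have hnt : (n : ℝ) ≤ √(n * t) := Real.le_sqrt_of_sq_le (by nlinarith)
    have hcs : |∑ i, ξs i ω * hs i ω| ≤ 2 * √v * √(n * t) * (A * B) := by
      refine abs_le_of_sq_le_sq ?_ (by positivity)
      calc (∑ i, ξs i ω * hs i ω) ^ 2 ≤ (∑ i, ξs i ω ^ 2) * ∑ i, hs i ω ^ 2 :=
            Finset.sum_mul_sq_le_sq_mul_sq _ _ _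
        _ ≤ (2 * n * v * A ^ 2) * (2 * t * B ^ 2) := by
            gcongr
            exact hcon.le.trans (by gcongr; linarith)
        _ = 4 * √v ^ 2 * √(n * t) ^ 2 * (A * B) ^ 2 := by
            rw [Real.sq_sqrt (by positivity), Real.sq_sqrt (by positivity)]; ring
        _ = _ := by ring
    calc |∑ i, (ξs i ω * hs i ω - m)| = |(∑ i, ξs i ω * hs i ω) - n * m| := by
          rw [Finset.sum_sub_distrib]; simp
      _ ≤ |∑ i, ξs i ω * hs i ω| + |n * m| := abs_sub _ _
      _ ≤ 2 * √v * √(n * t) * (A * B) + n * (A * B) := by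
          rw [abs_mul, Nat.abs_cast]; gcongr
      _ ≤ 2 * √v * √(n * t) * (A * B) + √v * √(n * t) * (A * B) := by
          gcongr; nlinarith [Real.sqrt_nonneg (n * t)]
      _ ≤ _ := by nlinarith [show 0 ≤ √v * √(n * t) * (A * B) by positivity]

end

end MultProc

/-! ### The `ψ₂`-norm as a pseudo-metric. -/

namespace MultProc

section

variable {Ω : Type*} [MeasurableSpace Ω] {μ : Measure Ω}

/-- The strict inequality provides an admissible scale below `K` without attainment of the infimum,
and covers norm zero. Estimates are therefore proved for every scale above the norm, then passed to
the limit. -/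
theorem hasPsi2Bound_of_psi2Norm_lt [IsProbabilityMeasure μ] {Y : Ω → ℝ} (hY : Measurable Y)
    {K : ℝ} (h : psi2Norm μ Y < ENNReal.ofReal K) : HasPsi2Bound μ Y K := by
  simp only [psi2Norm, iInf_lt_iff] at h
  obtain ⟨c, hc, hcY, hcK⟩ := h
  have hc' : (0 : ℝ) < c := hc
  have hcK' : (c : ℝ) ≤ K := by
    by_contra hcon
    rw [not_le] at hcon
    have := ENNReal.ofReal_le_ofReal hcon.le
    rw [ENNReal.ofReal_coe_nnreal] at this
    exact this.not_gt hcK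
  have hK : 0 < K := hc'.trans_le hcK'
  have hle : ∫⁻ ω, ENNReal.ofReal (Real.exp (Y ω ^ 2 / K ^ 2)) ∂μ ≤ 2 := by
    calc ∫⁻ ω, ENNReal.ofReal (Real.exp (Y ω ^ 2 / K ^ 2)) ∂μ
        ≤ ∫⁻ ω, (ENNReal.ofReal (psi2 (Y ω / c)) + 1) ∂μ := by
          refine lintegral_mono fun ω => ?_
          rw [← ENNReal.ofReal_one, ← ENNReal.ofReal_add _ zero_le_one]
          · refine ENNReal.ofReal_le_ofReal ?_
            rw [psi2, sub_add_cancel, div_pow]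
            gcongr
          · rw [psi2, sub_nonneg]; exact Real.one_le_exp (by positivity)
      _ = ∫⁻ ω, ENNReal.ofReal (psi2 (Y ω / c)) ∂μ + 1 := by
          rw [lintegral_add_right _ measurable_const]; simp
      _ ≤ 1 + 1 := by gcongr
      _ = 2 := by norm_num
  have hmeas : Measurable fun ω => Real.exp (Y ω ^ 2 / K ^ 2) := by fun_prop
  refine ⟨hY.aemeasurable, hK, ?_, ?_⟩
  · refine ⟨hmeas.aestronglyMeasurable, ?_⟩
    rw [hasFiniteIntegral_iff_ofReal (ae_of_all _ fun ω => (Real.exp_pos _).le)]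
    exact hle.trans_lt (by simp)
  · rw [integral_eq_lintegral_of_nonneg_ae (ae_of_all _ fun ω => (Real.exp_pos _).le)
      hmeas.aestronglyMeasurable]
    exact ENNReal.toReal_le_of_le_ofReal zero_le_two (by simpa using hle)

theorem HasPsi2Bound.psi2Norm_le [IsProbabilityMeasure μ] {Y : Ω → ℝ} {K : ℝ}
    (h : HasPsi2Bound μ Y K) : psi2Norm μ Y ≤ ENNReal.ofReal K := by
  refine iInf₂_le_of_le K.toNNReal (Real.toNNReal_pos.2 h.pos) (iInf_le_of_le ?_ le_rfl)
  have hint : Integrable (fun ω => psi2 (Y ω / K)) μ := by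
    simp only [psi2, div_pow]
    exact h.integrable.sub (integrable_const 1)
  rw [Real.coe_toNNReal _ h.pos.le, ← ofReal_integral_eq_lintegral_ofReal hint]
  · rw [← ENNReal.ofReal_one]
    refine ENNReal.ofReal_le_ofReal ?_
    simp only [psi2, div_pow]
    rw [integral_sub h.integrable (integrable_const 1)]
    simp only [integral_const, probReal_univ, smul_eq_mul, mul_one]
    linarith [h.le_two]
  · refine ae_of_all _ fun ω => ?_
    simp only [psi2, Pi.zero_apply, sub_nonneg]
    exact Real.one_le_exp (by positivity)

/-- `(X + Y)/(a + b)` is the convex combination of `X/a` and `Y/b` with weights proportional to `a`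
and `b`; convexity of the square and of `exp` does the rest. -/
theorem HasPsi2Bound.add [IsProbabilityMeasure μ] {X Y : Ω → ℝ} {a b : ℝ}
    (hX : HasPsi2Bound μ X a) (hY : HasPsi2Bound μ Y b) :
    HasPsi2Bound μ (fun ω => X ω + Y ω) (a + b) := by
  have ha := hX.pos
  have hb := hY.pos
  have hle : ∀ ω, Real.exp ((X ω + Y ω) ^ 2 / (a + b) ^ 2) ≤
      a / (a + b) * Real.exp (X ω ^ 2 / a ^ 2) + b / (a + b) * Real.exp (Y ω ^ 2 / b ^ 2) := by
    intro ω
    have hconv := convexOn_exp.2 (mem_univ (X ω ^ 2 / a ^ 2)) (mem_univ (Y ω ^ 2 / b ^ 2))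
      (show 0 ≤ a / (a + b) by positivity) (show 0 ≤ b / (a + b) by positivity)
      (by field_simp)
    simp only [smul_eq_mul] at hconv
    refine le_trans (Real.exp_le_exp.2 ?_) hconv
    rw [← sub_nonneg]
    have : a / (a + b) * (X ω ^ 2 / a ^ 2) + b / (a + b) * (Y ω ^ 2 / b ^ 2) -
        (X ω + Y ω) ^ 2 / (a + b) ^ 2 = (b * X ω - a * Y ω) ^ 2 / (a * b * (a + b) ^ 2) := by
      field_simp; ring
    rw [this]; positivity
  have hm : AEMeasurable (fun ω => X ω + Y ω) μ := hX.meas.add hY.meas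
  have hi1 := hX.integrable.const_mul (a / (a + b))
  have hi2 := hY.integrable.const_mul (b / (a + b))
  have hi : Integrable (fun ω => Real.exp ((X ω + Y ω) ^ 2 / (a + b) ^ 2)) μ := by
    refine (hi1.add hi2).mono' (AEMeasurable.aestronglyMeasurable ?_) (ae_of_all _ fun ω => ?_)
    · exact Real.measurable_exp.comp_aemeasurable ((hm.pow_const 2).div_const _)
    · rw [Real.norm_of_nonneg (Real.exp_pos _).le]; exact hle ω
  refine ⟨hm, by positivity, hi, (integral_mono hi (hi1.add hi2) hle).trans ?_⟩
  simp only [Pi.add_apply]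
  rw [integral_add hi1 hi2, integral_const_mul, integral_const_mul]
  calc _ ≤ a / (a + b) * 2 + b / (a + b) * 2 := by
        gcongr
        · exact hX.le_two
        · exact hY.le_two
    _ = 2 := by field_simp

theorem psi2Norm_add_le [IsProbabilityMeasure μ] {X Y : Ω → ℝ} (hX : Measurable X)
    (hY : Measurable Y) :
    psi2Norm μ (fun ω => X ω + Y ω) ≤ psi2Norm μ X + psi2Norm μ Y := by
  refine ENNReal.le_of_forall_pos_le_add fun ε hε hfin => ?_
  rw [ENNReal.add_lt_top] at hfin
  have hε' : (0 : ℝ) < ε := hε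
  have hlt : ∀ x : ℝ≥0∞, x < ∞ → x < ENNReal.ofReal (x.toReal + ε / 2) := by
    intro x hx
    rw [ENNReal.lt_ofReal_iff_toReal_lt hx.ne]
    linarith
  have h := ((hasPsi2Bound_of_psi2Norm_lt hX (hlt _ hfin.1)).add
    (hasPsi2Bound_of_psi2Norm_lt hY (hlt _ hfin.2))).psi2Norm_le
  refine h.trans (le_of_eq ?_)
  rw [show (psi2Norm μ X).toReal + (ε : ℝ) / 2 + ((psi2Norm μ Y).toReal + ε / 2) =
    (psi2Norm μ X).toReal + (psi2Norm μ Y).toReal + ε by ring,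
    ENNReal.ofReal_add (by positivity) hε'.le,
    ENNReal.ofReal_add (by positivity) (by positivity), ENNReal.ofReal_toReal hfin.1.ne,
    ENNReal.ofReal_toReal hfin.2.ne, ENNReal.ofReal_coe_nnreal]

theorem psi2Norm_neg (Y : Ω → ℝ) : psi2Norm μ (fun ω => -Y ω) = psi2Norm μ Y := by
  simp only [psi2Norm, psi2, neg_div, even_two.neg_pow]

theorem psi2Dist_comm (f g : Ω → ℝ) : psi2Dist μ f g = psi2Dist μ g f := by
  rw [psi2Dist, psi2Dist, ← psi2Norm_neg]
  simp only [neg_sub]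

theorem psi2Dist_triangle [IsProbabilityMeasure μ] {f g h : Ω → ℝ} (hf : Measurable f)
    (hg : Measurable g) (hh : Measurable h) :
    psi2Dist μ f h ≤ psi2Dist μ f g + psi2Dist μ g h := by
  have := psi2Norm_add_le (μ := μ) (X := fun ω => f ω - g ω) (Y := fun ω => g ω - h ω)
    (hf.sub hg) (hg.sub hh)
  simpa only [psi2Dist, sub_add_sub_cancel] using this

theorem psi2Dist_zero (f : Ω → ℝ) : psi2Dist μ f 0 = psi2Norm μ f := by
  simp [psi2Dist]

theorem psi2Dist_lt_top [IsProbabilityMeasure μ] {f g : Ω → ℝ} (hf : f ∈ Lpsi2 μ)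
    (hg : g ∈ Lpsi2 μ) : psi2Dist μ f g < ∞ := by
  refine (psi2Dist_triangle (g := 0) hf.1 measurable_const hg.1).trans_lt ?_
  rw [psi2Dist_comm 0 g, psi2Dist_zero, psi2Dist_zero]
  exact ENNReal.add_lt_top.2 ⟨hf.2, hg.2⟩

theorem psi2Dist_le_two_mul_radius [IsProbabilityMeasure μ] {F : Set (Ω → ℝ)}
    (hF : F ⊆ Lpsi2 μ) {f g : Ω → ℝ} (hf : f ∈ F) (hg : g ∈ F) :
    psi2Dist μ f g ≤ 2 * radius μ F := by
  refine (psi2Dist_triangle (g := 0) (hF hf).1 measurable_const (hF hg).1).trans ?_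
  rw [psi2Dist_comm 0 g, two_mul]
  exact add_le_add (le_iSup₂ (f := fun f (_ : f ∈ F) => psi2Dist μ f 0) f hf)
    (le_iSup₂ (f := fun f (_ : f ∈ F) => psi2Dist μ f 0) g hg)

end

end MultProc

/-! ### Increments of the multiplier process. -/

namespace MultProc

open Filter Topology

theorem tendsto_const_mul_ofReal_toReal_add {N c : ℝ≥0∞} (hN : N < ∞) (hc : c ≠ ∞) :
    Tendsto (fun m : ℕ => c * ENNReal.ofReal (N.toReal + 1 / ((m : ℝ) + 1))) atTop
      (𝓝 (c * N)) := by
  refine ENNReal.Tendsto.const_mul ?_ (Or.inr hc)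
  have h := (tendsto_one_div_add_atTop_nhds_zero_nat (𝕜 := ℝ)).const_add N.toReal
  rw [add_zero] at h
  have h2 := ENNReal.tendsto_ofReal h
  rwa [ENNReal.ofReal_toReal hN.ne] at h2

theorem lt_ofReal_toReal_add {N : ℝ≥0∞} (hN : N < ∞) (m : ℕ) :
    N < ENNReal.ofReal (N.toReal + 1 / ((m : ℝ) + 1)) := by
  rw [ENNReal.lt_ofReal_iff_toReal_lt hN.ne]
  have : (0 : ℝ) < 1 / ((m : ℝ) + 1) := by positivity
  linarith

/-- As `K` decreases to `N` the events increase, and the strict inequality puts the limit event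
inside their union; continuity from below needs no measurability. -/
theorem measure_mul_lt_le_of_forall_lt {Ω : Type*} [MeasurableSpace Ω] {μ : Measure Ω}
    {G : Set Ω} {S : Ω → ℝ≥0∞} {N c p : ℝ≥0∞} (hN : N < ∞) (hc : c ≠ ∞)
    (h : ∀ K : ℝ, N < ENNReal.ofReal K → μ {ω | ω ∈ G ∧ c * ENNReal.ofReal K < S ω} ≤ p) :
    μ {ω | ω ∈ G ∧ c * N < S ω} ≤ p := by
  set Z : ℕ → Set Ω := fun m =>
    {ω | ω ∈ G ∧ c * ENNReal.ofReal (N.toReal + 1 / ((m : ℝ) + 1)) < S ω} with hZ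
  have hmono : Monotone Z := by
    rintro m m' hm ω ⟨hG, hω⟩
    refine ⟨hG, lt_of_le_of_lt ?_ hω⟩
    gcongr
  have hsub : {ω | ω ∈ G ∧ c * N < S ω} ⊆ ⋃ m, Z m := by
    rintro ω ⟨hG, hω⟩
    obtain ⟨m, hm⟩ := ((tendsto_const_mul_ofReal_toReal_add hN hc).eventually_lt_const hω).exists
    exact mem_iUnion.2 ⟨m, hG, hm⟩
  refine (measure_mono hsub).trans ?_
  rw [hmono.measure_iUnion]
  exact iSup_le fun m => h _ (lt_ofReal_toReal_add hN m)

/-- An iid sample `(ξᵢ, Xᵢ)` of size `n` from the law of `(ξ, X)`, with multipliers that are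
subgaussian at scale `A`. -/
structure IsMultSample {Ω₀ Ω B : Type*} [MeasurableSpace Ω₀] [MeasurableSpace Ω]
    [MeasurableSpace B] (ν : Measure Ω₀) (ξ : Ω₀ → ℝ) (X : Ω₀ → B) (μ : Measure Ω) {n : ℕ}
    (ξs : Fin n → Ω → ℝ) (Xs : Fin n → Ω → B) (A : ℝ) : Prop where
  one_le : 1 ≤ n
  meas_X : Measurable X
  meas_ξs : ∀ i, Measurable (ξs i)
  meas_Xs : ∀ i, Measurable (Xs i)
  indep : iIndepFun (fun i ω => (ξs i ω, Xs i ω)) μ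
  ident : ∀ i, IdentDistrib (fun ω => (ξs i ω, Xs i ω)) (fun ω₀ => (ξ ω₀, X ω₀)) μ ν
  bound : HasPsi2Bound ν ξ A

namespace IsMultSample

variable {Ω₀ Ω B : Type*} [MeasurableSpace Ω₀] [MeasurableSpace Ω] [MeasurableSpace B]
  {ν : Measure Ω₀} {ξ : Ω₀ → ℝ} {X : Ω₀ → B} {μ : Measure Ω}
  {n : ℕ} {ξs : Fin n → Ω → ℝ} {Xs : Fin n → Ω → B} {A : ℝ}

theorem hasPsi2Bound_comp [IsProbabilityMeasure ν]
    (H : IsMultSample ν ξ X μ ξs Xs A) {h : B → ℝ} (hh : Measurable h)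
    {K : ℝ} (hK : psi2Norm (ν.map X) h < ENNReal.ofReal K) :
    HasPsi2Bound ν (fun ω => h (X ω)) K := by
  have := Measure.isProbabilityMeasure_map (μ := ν) H.meas_X.aemeasurable
  have hb := hasPsi2Bound_of_psi2Norm_lt hh hK
  have hm : AEStronglyMeasurable (fun b => Real.exp (h b ^ 2 / K ^ 2)) (ν.map X) :=
    hb.integrable.1
  refine ⟨(hh.comp H.meas_X).aemeasurable, hb.pos, ?_, ?_⟩
  · exact (integrable_map_measure hm H.meas_X.aemeasurable).1 hb.integrable
  · have := hb.le_two
    rwa [integral_map H.meas_X.aemeasurable hm] at this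

theorem identDistrib_mul (H : IsMultSample ν ξ X μ ξs Xs A) {h : B → ℝ} (hh : Measurable h)
    (i : Fin n) :
    IdentDistrib (fun ω => ξs i ω * h (Xs i ω)) (fun ω₀ => ξ ω₀ * h (X ω₀)) μ ν :=
  (H.ident i).comp (u := fun p : ℝ × B => p.1 * h p.2)
    (measurable_fst.mul (hh.comp measurable_snd))

theorem hasPsi2Bound_ξs (H : IsMultSample ν ξ X μ ξs Xs A) (i : Fin n) :
    HasPsi2Bound μ (ξs i) A :=
  H.bound.of_identDistrib ((H.ident i).comp (u := Prod.fst) measurable_fst)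

theorem hasPsi2Bound_comp_Xs [IsProbabilityMeasure ν]
    (H : IsMultSample ν ξ X μ ξs Xs A) {h : B → ℝ} (hh : Measurable h)
    {K : ℝ} (hK : psi2Norm (ν.map X) h < ENNReal.ofReal K) (i : Fin n) :
    HasPsi2Bound μ (fun ω => h (Xs i ω)) K :=
  (H.hasPsi2Bound_comp hh hK).of_identDistrib
    ((H.ident i).comp (u := fun p : ℝ × B => h p.2) (hh.comp measurable_snd))

theorem exists_lt_ofReal {x : ℝ≥0∞} (hx : x < ∞) : ∃ K : ℝ, x < ENNReal.ofReal K :=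
  ⟨_, lt_ofReal_toReal_add hx 0⟩

theorem integrable_mul [IsProbabilityMeasure ν]
    (H : IsMultSample ν ξ X μ ξs Xs A) {f : B → ℝ}
    (hf : f ∈ Lpsi2 (ν.map X)) : Integrable (fun ω => ξ ω * f (X ω)) ν := by
  obtain ⟨K, hK⟩ := exists_lt_ofReal hf.2
  exact (H.bound.mul (H.hasPsi2Bound_comp hf.1 hK)).integrable_self

theorem multM_sub_multM [IsProbabilityMeasure ν]
    (H : IsMultSample ν ξ X μ ξs Xs A) {f g : B → ℝ}
    (hf : f ∈ Lpsi2 (ν.map X)) (hg : g ∈ Lpsi2 (ν.map X)) (ω : Ω) :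
    multM ν ξ X ξs Xs f ω - multM ν ξ X ξs Xs g ω =
      (∑ i, (ξs i ω * (f (Xs i ω) - g (Xs i ω)) -
        ∫ ω₀, ξ ω₀ * (f (X ω₀) - g (X ω₀)) ∂ν)) / n := by
  rw [multM, multM, ← mul_sub, ← Finset.sum_sub_distrib, one_div, inv_mul_eq_div]
  congr 1
  refine Finset.sum_congr rfl fun i _ => ?_
  simp only [mul_sub]
  rw [integral_sub (H.integrable_mul hf) (H.integrable_mul hg)]
  ring

theorem edist_multM [IsProbabilityMeasure ν]
    (H : IsMultSample ν ξ X μ ξs Xs A) {f g : B → ℝ}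
    (hf : f ∈ Lpsi2 (ν.map X)) (hg : g ∈ Lpsi2 (ν.map X)) (ω : Ω) :
    edist (multM ν ξ X ξs Xs f ω) (multM ν ξ X ξs Xs g ω) =
      ENNReal.ofReal (|∑ i, (ξs i ω * (f (Xs i ω) - g (Xs i ω)) -
        ∫ ω₀, ξ ω₀ * (f (X ω₀) - g (X ω₀)) ∂ν)| / n) := by
  rw [edist_dist, Real.dist_eq, H.multM_sub_multM hf hg, abs_div, Nat.abs_cast]

theorem iIndepFun_mul (H : IsMultSample ν ξ X μ ξs Xs A) {h : B → ℝ} (hh : Measurable h) :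
    iIndepFun (fun i ω => ξs i ω * h (Xs i ω)) μ :=
  H.indep.comp (fun _ (p : ℝ × B) => p.1 * h p.2)
    fun _ => measurable_fst.mul (hh.comp measurable_snd)

theorem iIndepFun_comp (H : IsMultSample ν ξ X μ ξs Xs A) {h : B → ℝ} (hh : Measurable h) :
    iIndepFun (fun i ω => h (Xs i ω)) μ :=
  H.indep.comp (fun _ (p : ℝ × B) => h p.2) fun _ => hh.comp measurable_snd

theorem measure_sum_sq_gt_le [IsProbabilityMeasure μ]
    (H : IsMultSample ν ξ X μ ξs Xs A) {v : ℝ} (hv : 1 ≤ v) :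
    μ {ω | ∑ i, ξs i ω ^ 2 ≤ 2 * n * v * A ^ 2}ᶜ ≤ ENNReal.ofReal (Real.exp (-(n * v))) := by
  have h := measureReal_sum_sq_ge_le H.bound.pos H.meas_ξs
    (H.indep.comp (fun _ => Prod.fst) fun _ => measurable_fst) H.hasPsi2Bound_ξs (n * v)
  rw [← ENNReal.ofReal_toReal (measure_ne_top μ _)]
  refine ENNReal.ofReal_le_ofReal (le_trans (measureReal_mono ?_) h)
  intro ω hω
  simp only [mem_compl_iff, mem_ofPred_eq, not_le] at hω ⊢
  refine le_trans ?_ hω.le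
  have : (n : ℝ) ≤ n * v := le_mul_of_one_le_right (by positivity) hv
  gcongr
  linarith

theorem measure_edist_multM_gt_le [IsProbabilityMeasure ν] [IsProbabilityMeasure μ]
    (H : IsMultSample ν ξ X μ ξs Xs A) {f g : B → ℝ}
    (hf : f ∈ Lpsi2 (ν.map X)) (hg : g ∈ Lpsi2 (ν.map X)) {t : ℝ} (ht : 0 ≤ t) :
    μ {ω | ENNReal.ofReal (10 * A * (√(t / n) + t / n)) * psi2Dist (ν.map X) f g <
      edist (multM ν ξ X ξs Xs f ω) (multM ν ξ X ξs Xs g ω)} ≤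
      ENNReal.ofReal (2 * Real.exp (-t)) := by
  have hP := Measure.isProbabilityMeasure_map (μ := ν) H.meas_X.aemeasurable
  have hhm : Measurable fun b => f b - g b := hf.1.sub hg.1
  have hA := H.bound.pos
  have hn : (0 : ℝ) < n := by exact_mod_cast H.one_le
  have key := measure_mul_lt_le_of_forall_lt (μ := μ) (G := univ)
    (S := fun ω => edist (multM ν ξ X ξs Xs f ω) (multM ν ξ X ξs Xs g ω))
    (c := ENNReal.ofReal (10 * A * (√(t / n) + t / n))) (p := ENNReal.ofReal (2 * Real.exp (-t)))
    (psi2Dist_lt_top hf hg) ENNReal.ofReal_ne_top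
  simp only [mem_univ, true_and] at key
  refine key fun K hK => ?_
  have h := measureReal_abs_sum_sub_mean_ge_le H.one_le
    (fun i => (H.meas_ξs i).mul (hhm.comp (H.meas_Xs i))) (H.iIndepFun_mul hhm)
    (fun i => (H.hasPsi2Bound_ξs i).mul (H.hasPsi2Bound_comp_Xs hhm hK i))
    (fun i => (H.identDistrib_mul hhm i).integral_eq) ht
  rw [← ENNReal.ofReal_toReal (measure_ne_top μ _)]
  refine ENNReal.ofReal_le_ofReal (le_trans (measureReal_mono fun ω hω => ?_) h)
  have hK0 := (H.hasPsi2Bound_comp hhm hK).pos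
  simp only [mem_ofPred_eq] at hω ⊢
  rw [H.edist_multM hf hg, ← ENNReal.ofReal_mul (by positivity)] at hω
  have h1 := ((ENNReal.ofReal_lt_ofReal_iff_of_nonneg (by positivity)).1 hω).le
  rw [le_div_iff₀ hn] at h1
  refine le_trans (le_of_eq ?_) h1
  have h2 : √(n * t) = √(t / n) * n := by
    rw [show (n : ℝ) * t = t / n * (n * n) by field_simp, Real.sqrt_mul (by positivity),
      Real.sqrt_mul_self hn.le]
  rw [h2]; field_simp

theorem measure_inter_edist_multM_gt_le [IsProbabilityMeasure ν] [IsProbabilityMeasure μ]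
    (H : IsMultSample ν ξ X μ ξs Xs A) {f g : B → ℝ}
    (hf : f ∈ Lpsi2 (ν.map X)) (hg : g ∈ Lpsi2 (ν.map X)) {t v : ℝ} (ht : 0 ≤ t) (hv : 1 ≤ v) :
    μ {ω | ω ∈ {ω | ∑ i, ξs i ω ^ 2 ≤ 2 * n * v * A ^ 2} ∧
      ENNReal.ofReal (20 * A * √v * √(t / n)) * psi2Dist (ν.map X) f g <
        edist (multM ν ξ X ξs Xs f ω) (multM ν ξ X ξs Xs g ω)} ≤
      ENNReal.ofReal (2 * Real.exp (-t)) := by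
  have hP := Measure.isProbabilityMeasure_map (μ := ν) H.meas_X.aemeasurable
  have hhm : Measurable fun b => f b - g b := hf.1.sub hg.1
  have hA := H.bound.pos
  have hn : (0 : ℝ) < n := by exact_mod_cast H.one_le
  refine measure_mul_lt_le_of_forall_lt (psi2Dist_lt_top hf hg) ENNReal.ofReal_ne_top
    fun K hK => ?_
  have h := measureReal_sum_mul_deviation_le H.one_le hv H.meas_ξs
    (fun i => hhm.comp (H.meas_Xs i)) (H.iIndepFun_mul hhm) (H.iIndepFun_comp hhm)
    H.hasPsi2Bound_ξs (H.hasPsi2Bound_comp_Xs hhm hK)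
    (fun i => (H.identDistrib_mul hhm i).integral_eq) ht
  rw [← ENNReal.ofReal_toReal (measure_ne_top μ _)]
  refine ENNReal.ofReal_le_ofReal (le_trans (measureReal_mono fun ω hω => ?_) h)
  have hK0 := (H.hasPsi2Bound_comp hhm hK).pos
  refine ⟨hω.1, ?_⟩
  have hω := hω.2
  rw [H.edist_multM hf hg, ← ENNReal.ofReal_mul (by positivity)] at hω
  have h1 := (ENNReal.ofReal_lt_ofReal_iff_of_nonneg (by positivity)).1 hω
  rw [lt_div_iff₀ hn] at h1
  refine lt_of_le_of_lt (le_of_eq ?_) h1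
  have h2 : √(n * t) = √(t / n) * n := by
    rw [show (n : ℝ) * t = t / n * (n * n) by field_simp, Real.sqrt_mul (by positivity),
      Real.sqrt_mul_self hn.le]
  rw [h2]; ring

/-- A crude `L¹` bound with no gain from `n`; its purpose is the almost sure convergence of the
chains. -/
theorem lintegral_edist_multM_le [IsProbabilityMeasure ν] [IsProbabilityMeasure μ]
    (H : IsMultSample ν ξ X μ ξs Xs A) {f g : B → ℝ}
    (hf : f ∈ Lpsi2 (ν.map X)) (hg : g ∈ Lpsi2 (ν.map X)) :
    ∫⁻ ω, edist (multM ν ξ X ξs Xs f ω) (multM ν ξ X ξs Xs g ω) ∂μ ≤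
      ENNReal.ofReal (2 * A) * psi2Dist (ν.map X) f g := by
  have hP := Measure.isProbabilityMeasure_map (μ := ν) H.meas_X.aemeasurable
  have hhm : Measurable fun b => f b - g b := hf.1.sub hg.1
  have hA := H.bound.pos
  have hn : (0 : ℝ) < n := by exact_mod_cast H.one_le
  have hfin := psi2Dist_lt_top hf hg
  refine ge_of_tendsto' (tendsto_const_mul_ofReal_toReal_add hfin ENNReal.ofReal_ne_top)
    fun m => ?_
  have hK := lt_ofReal_toReal_add hfin m
  set K := (psi2Dist (ν.map X) f g).toReal + 1 / ((m : ℝ) + 1)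
  set e := ∫ ω₀, ξ ω₀ * (f (X ω₀) - g (X ω₀)) ∂ν with he
  have hb := fun i => (H.hasPsi2Bound_ξs i).mul (H.hasPsi2Bound_comp_Xs hhm hK i)
  have hb0 := H.bound.mul (H.hasPsi2Bound_comp hhm hK)
  have he1 : |e| ≤ A * K := abs_integral_le_integral_abs.trans hb0.integral_abs_le
  have hi : ∀ i, Integrable (fun ω => |ξs i ω * (f (Xs i ω) - g (Xs i ω)) - e|) μ :=
    fun i => ((hb i).integrable_self.sub (integrable_const e)).abs
  have hi2 : Integrable (fun ω => |∑ i, (ξs i ω * (f (Xs i ω) - g (Xs i ω)) - e)| / n) μ :=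
    (integrable_finsetSum _ fun i _ =>
      (hb i).integrable_self.sub (integrable_const e)).abs.div_const _
  simp only [H.edist_multM hf hg]
  rw [← ofReal_integral_eq_lintegral_ofReal hi2 (ae_of_all _ fun ω => by positivity),
    ← ENNReal.ofReal_mul (by positivity)]
  refine ENNReal.ofReal_le_ofReal ?_
  rw [integral_div, div_le_iff₀ hn]
  have hone : ∀ i, ∫ ω, |ξs i ω * (f (Xs i ω) - g (Xs i ω)) - e| ∂μ ≤ 2 * A * K := by
    intro i
    have h1 : ∫ ω, |ξs i ω * (f (Xs i ω) - g (Xs i ω)) - e| ∂μ ≤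
        ∫ ω, (|ξs i ω * (f (Xs i ω) - g (Xs i ω))| + |e|) ∂μ :=
      integral_mono (hi i) ((hb i).integrable_self.abs.add (integrable_const _))
        fun ω => abs_sub _ _
    rw [integral_add (hb i).integrable_self.abs (integrable_const _)] at h1
    simp only [integral_const, probReal_univ, smul_eq_mul, one_mul] at h1
    linarith [(hb i).integral_abs_le]
  calc ∫ ω, |∑ i, (ξs i ω * (f (Xs i ω) - g (Xs i ω)) - e)| ∂μ
      ≤ ∫ ω, ∑ i, |ξs i ω * (f (Xs i ω) - g (Xs i ω)) - e| ∂μ :=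
        integral_mono_of_nonneg (ae_of_all _ fun ω => abs_nonneg _)
          (integrable_finsetSum _ fun i _ => hi i)
          (ae_of_all _ fun ω => Finset.abs_sum_le_sum_abs _ _)
    _ = ∑ i, ∫ ω, |ξs i ω * (f (Xs i ω) - g (Xs i ω)) - e| ∂μ :=
        integral_finsetSum _ fun i _ => hi i
    _ ≤ ∑ _i : Fin n, 2 * A * K := Finset.sum_le_sum fun i _ => hone i
    _ = 2 * A * K * n := by simp; ring

end IsMultSample

end MultProc

/-! ### Deterministic chaining and union-bound estimates. -/

namespace MultProc

open Filter Topology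

/-- The infimum need not be attained, hence the factor `2`, which leaves room when `0 < γ₂ < ∞`. If
`γ₂ = 0`, the `k = 0` terms, where `A 0` is a single point, force all distances to vanish, and the
constant sequence `{f₀}` works. -/
theorem exists_isAdmissible_tsum_le {T : Type*} {d : T → T → ℝ≥0∞} {F : Set T} {f₀ : T}
    (hf₀ : f₀ ∈ F) (hcomm : ∀ f g, d f g = d g f)
    (htri : ∀ f ∈ F, ∀ g ∈ F, ∀ h ∈ F, d f h ≤ d f g + d g h) (hfin : gamma2 d F < ∞) :
    ∃ A, IsAdmissible d F A ∧
      ∀ f ∈ F, ∑' k : ℕ, (2 : ℝ≥0∞) ^ ((k : ℝ) / 2) * distTo d f (A k) ≤ 2 * gamma2 d F := by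
  rcases eq_or_ne (gamma2 d F) 0 with h0 | h0
  · have hd : ∀ f ∈ F, d f f₀ = 0 := by
      intro f hf
      refine le_antisymm (ENNReal.le_of_forall_pos_le_add fun ε hε _ => ?_) zero_le
      have hε' : gamma2 d F < (ε / 2 : ℝ≥0) := by
        rw [h0]; exact_mod_cast half_pos hε
      simp only [gamma2, iInf_lt_iff] at hε'
      obtain ⟨A, hA, hlt⟩ := hε'
      obtain ⟨s, hs⟩ := encard_eq_one.1 hA.card_zero
      have hsF : s ∈ F := hA.subset 0 (by simp [hs])
      have key : ∀ g ∈ F, d g s ≤ (ε / 2 : ℝ≥0) := by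
        intro g hg
        refine le_trans ?_ ((le_iSup₂ (f := fun t (_ : t ∈ F) =>
          ∑' k : ℕ, (2 : ℝ≥0∞) ^ ((k : ℝ) / 2) * distTo d t (A k)) g hg).trans hlt.le)
        refine le_trans (le_of_eq ?_) (ENNReal.le_tsum 0)
        simp [distTo, hs]
      calc d f f₀ ≤ d f s + d s f₀ := htri f hf s hsF f₀ hf₀
        _ ≤ (ε / 2 : ℝ≥0) + (ε / 2 : ℝ≥0) := by
            rw [hcomm s f₀]; exact add_le_add (key f hf) (key f₀ hf₀)
        _ = 0 + ε := by rw [zero_add, ← ENNReal.coe_add, add_halves]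
    refine ⟨fun _ => {f₀}, ⟨fun _ => singleton_subset_iff.2 hf₀, encard_singleton _, fun k => ?_,
      fun f hf ε hε => ⟨0, f₀, rfl, by rwa [hd f hf]⟩⟩, fun f hf => ?_⟩
    · rw [encard_singleton]; exact one_le_pow₀ one_le_two
    · simp [distTo, hd f hf]
  · have hlt : gamma2 d F < 2 * gamma2 d F := by
      rw [two_mul]; exact ENNReal.lt_add_right hfin.ne h0
    rw [gamma2] at hlt
    simp only [iInf_lt_iff] at hlt
    obtain ⟨A, hA, hlt⟩ := hlt
    exact ⟨A, hA, fun f hf => (le_iSup₂ (f := fun t (_ : t ∈ F) =>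
      ∑' k : ℕ, (2 : ℝ≥0∞) ^ ((k : ℝ) / 2) * distTo d t (A k)) f hf).trans hlt.le⟩

theorem exists_mem_eq_distTo {T : Type*} {d : T → T → ℝ≥0∞} {A : Set T} (hA : A.Finite)
    (hne : A.Nonempty) (t : T) : ∃ s ∈ A, d t s = distTo d t A := by
  obtain ⟨s, hs, hmin⟩ := exists_min_image A (d t) hA hne
  exact ⟨s, hs, le_antisymm (le_iInf₂ hmin) (iInf₂_le s hs)⟩

theorem tsum_two_rpow_mul_add_le (δ : ℕ → ℝ≥0∞) :
    ∑' k : ℕ, (2 : ℝ≥0∞) ^ ((k : ℝ) / 2) * (δ (k + 1) + δ k) ≤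
      2 * ∑' k : ℕ, (2 : ℝ≥0∞) ^ ((k : ℝ) / 2) * δ k := by
  simp only [mul_add]
  rw [ENNReal.tsum_add, two_mul]
  refine add_le_add (le_trans (ENNReal.tsum_le_tsum fun k => ?_)
    (ENNReal.tsum_comp_le_tsum_of_injective (add_left_injective 1)
      fun k : ℕ => (2 : ℝ≥0∞) ^ ((k : ℝ) / 2) * δ k)) le_rfl
  gcongr
  · norm_num
  · simp

theorem edist_le_of_chain {M : ℕ → ℝ} {δ : ℕ → ℝ≥0∞} {L x : ℝ≥0∞} {y z : ℝ} {l : ℕ}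
    (hlim : Tendsto M atTop (𝓝 y)) (hstart : edist (M l) z ≤ x)
    (hlink : ∀ k, l ≤ k →
      edist (M (k + 1)) (M k) ≤ L * ((2 : ℝ≥0∞) ^ ((k : ℝ) / 2) * (δ (k + 1) + δ k))) :
    edist y z ≤ L * (2 * ∑' k : ℕ, (2 : ℝ≥0∞) ^ ((k : ℝ) / 2) * δ k) + x := by
  have hlim' : Tendsto (fun m => edist (M (l + m)) z) atTop (𝓝 (edist y z)) :=
    ((hlim.comp (tendsto_add_atTop_nat l)).congr fun m => by simp [add_comm]).edist
      tendsto_const_nhds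
  refine le_of_tendsto' hlim' fun m => (edist_triangle _ (M l) _).trans (add_le_add ?_ hstart)
  rw [edist_comm]
  calc edist (M l) (M (l + m))
      ≤ ∑ j ∈ Finset.range m, edist (M (l + j)) (M (l + (j + 1))) :=
        edist_le_range_sum_edist (fun j => M (l + j)) m
    _ ≤ ∑ j ∈ Finset.range m, L * ((2 : ℝ≥0∞) ^ (((l + j : ℕ) : ℝ) / 2) *
          (δ (l + j + 1) + δ (l + j))) := by
        refine Finset.sum_le_sum fun j _ => ?_
        rw [edist_comm]; exact hlink _ (Nat.le_add_right _ _)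
    _ ≤ L * ∑' k : ℕ, (2 : ℝ≥0∞) ^ ((k : ℝ) / 2) * (δ (k + 1) + δ k) := by
        rw [← Finset.mul_sum]
        gcongr
        exact (ENNReal.sum_le_tsum _).trans (ENNReal.tsum_comp_le_tsum_of_injective
          (add_right_injective l) fun k : ℕ => (2 : ℝ≥0∞) ^ ((k : ℝ) / 2) * (δ (k + 1) + δ k))
    _ ≤ _ := by gcongr; exact tsum_two_rpow_mul_add_le δ

theorem measure_biUnion_le_of_encard_le {Ω ι : Type*} [MeasurableSpace Ω] {μ : Measure Ω}
    {s : Set ι} {N : ℕ} (hs : s.encard ≤ N) {Z : ι → Set Ω} {p : ℝ≥0∞}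
    (hZ : ∀ i ∈ s, μ (Z i) ≤ p) : μ (⋃ i ∈ s, Z i) ≤ N * p := by
  have hfin : s.Finite := finite_of_encard_le_coe hs
  have h1 : ⋃ i ∈ s, Z i = ⋃ i ∈ hfin.toFinset, Z i := by simp
  rw [h1]
  refine (measure_biUnion_finset_le _ _).trans ?_
  refine (Finset.sum_le_card_nsmul _ _ p fun i hi => hZ i (hfin.mem_toFinset.1 hi)).trans ?_
  rw [nsmul_eq_mul]
  gcongr
  rw [hfin.encard_eq_coe_toFinset_card] at hs
  exact_mod_cast hs

/-- With `k = l + j`, there are at most `2^(3·2^k)` links between levels `k` and `k + 1`. The level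
`8·2^k` beats this count and leaves `exp(-5·2^k)`: one factor `exp(-2^k)` yields `exp(-u)`, another
the summable `2^(-j)`. -/
theorem two_pow_mul_exp_le {u : ℝ} {l : ℕ} (hl : u ≤ 2 ^ l) (j : ℕ) :
    ((2 ^ 2 ^ (l + j + 1) * 2 ^ 2 ^ (l + j) : ℕ) : ℝ) * (2 * Real.exp (-(8 * 2 ^ (l + j)))) ≤
      2 * Real.exp (-u) * (1 / 2) ^ j := by
  have h2 : (2 : ℝ) ≤ Real.exp 1 := by linarith [Real.add_one_le_exp 1]
  have hcard : ((2 ^ 2 ^ (l + j + 1) * 2 ^ 2 ^ (l + j) : ℕ) : ℝ) ≤ Real.exp (3 * 2 ^ (l + j)) := by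
    rw [← pow_add]
    push_cast
    calc (2 : ℝ) ^ (2 ^ (l + j + 1) + 2 ^ (l + j)) ≤
          Real.exp 1 ^ (2 ^ (l + j + 1) + 2 ^ (l + j)) := by gcongr
      _ = _ := by rw [← Real.exp_nat_mul]; congr 1; push_cast; ring
  have hj : ((j : ℕ) : ℝ) ≤ 2 ^ (l + j) := by
    have : j < 2 ^ j := Nat.lt_two_pow_self
    have h3 : 2 ^ j ≤ 2 ^ (l + j) := Nat.pow_le_pow_right two_pos (Nat.le_add_left _ _)
    exact_mod_cast this.le.trans h3
  have hu : u ≤ 2 ^ (l + j) :=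
    hl.trans (pow_le_pow_right₀ one_le_two (Nat.le_add_right _ _))
  have hhalf : Real.exp (-j) ≤ (1 / 2) ^ j := by
    rw [Real.exp_neg, one_div, inv_pow]
    gcongr
    calc (2 : ℝ) ^ j ≤ Real.exp 1 ^ j := by gcongr
      _ = _ := by rw [← Real.exp_nat_mul]; simp
  calc _ ≤ Real.exp (3 * 2 ^ (l + j)) * (2 * Real.exp (-(8 * 2 ^ (l + j)))) := by gcongr
    _ = 2 * Real.exp (3 * 2 ^ (l + j) + -(8 * 2 ^ (l + j))) := by rw [Real.exp_add]; ring
    _ ≤ 2 * Real.exp (-u + -j) := by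
        refine mul_le_mul_of_nonneg_left (Real.exp_le_exp.2 ?_) zero_le_two
        linarith [show (0 : ℝ) < 2 ^ (l + j) by positivity]
    _ = 2 * Real.exp (-u) * Real.exp (-j) := by rw [Real.exp_add]; ring
    _ ≤ _ := by gcongr

/-- The good event involves an uncountable class and may fail to be measurable; the complement of a
measurable hull of the bad event replaces it. -/
theorem exists_measurableSet_of_measure_compl_le {Ω : Type*} [MeasurableSpace Ω] {μ : Measure Ω}
    [IsProbabilityMeasure μ] {G : Set Ω} {p : ℝ} (hp : 0 ≤ p) (h : μ Gᶜ ≤ ENNReal.ofReal p) :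
    ∃ E ⊆ G, MeasurableSet E ∧ 1 - p ≤ μ.real E := by
  refine ⟨(toMeasurable μ Gᶜ)ᶜ, ?_, (measurableSet_toMeasurable _ _).compl, ?_⟩
  · rw [compl_subset_comm]; exact subset_toMeasurable _ _
  · rw [probReal_compl_eq_one_sub (measurableSet_toMeasurable _ _)]
    have : μ.real (toMeasurable μ Gᶜ) ≤ p := by
      rw [measureReal_def, measure_toMeasurable]
      exact ENNReal.toReal_le_of_le_ofReal hp h
    linarith

end MultProc

/-! ### Chaining for the multiplier process. -/

namespace MultProc

open Filter Topology

namespace IsMultSample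

variable {Ω₀ Ω B : Type*} [MeasurableSpace Ω₀] [MeasurableSpace Ω] [MeasurableSpace B]
  {ν : Measure Ω₀} {ξ : Ω₀ → ℝ} {X : Ω₀ → B} {μ : Measure Ω}
  {n : ℕ} {ξs : Fin n → Ω → ℝ} {Xs : Fin n → Ω → B} {A : ℝ}

theorem measurable_multM (H : IsMultSample ν ξ X μ ξs Xs A) {f : B → ℝ} (hf : Measurable f) :
    Measurable (multM ν ξ X ξs Xs f) := by
  unfold multM
  refine (Finset.measurable_sum _ fun i _ => ?_).const_mul _
  exact ((H.meas_ξs i).mul (hf.comp (H.meas_Xs i))).sub_const _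

/-- The increments have summable expectations, so their sum is almost surely finite and its terms
tend to zero. -/
theorem ae_tendsto_multM [IsProbabilityMeasure ν] [IsProbabilityMeasure μ]
    (H : IsMultSample ν ξ X μ ξs Xs A) {f : B → ℝ} {g : ℕ → B → ℝ}
    (hf : f ∈ Lpsi2 (ν.map X)) (hg : ∀ k, g k ∈ Lpsi2 (ν.map X))
    (hsum : ∑' k, psi2Dist (ν.map X) f (g k) < ∞) :
    ∀ᵐ ω ∂μ, Tendsto (fun k => multM ν ξ X ξs Xs (g k) ω) atTop
      (𝓝 (multM ν ξ X ξs Xs f ω)) := by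
  have hmeas : ∀ k, Measurable fun ω =>
      edist (multM ν ξ X ξs Xs f ω) (multM ν ξ X ξs Xs (g k) ω) := fun k =>
    (H.measurable_multM hf.1).edist (H.measurable_multM (hg k).1)
  have hfin : ∫⁻ ω, ∑' k, edist (multM ν ξ X ξs Xs f ω) (multM ν ξ X ξs Xs (g k) ω) ∂μ ≠ ∞ := by
    rw [lintegral_tsum fun k => (hmeas k).aemeasurable]
    refine ne_top_of_le_ne_top ?_
      (ENNReal.tsum_le_tsum fun k => H.lintegral_edist_multM_le hf (hg k))
    rw [ENNReal.tsum_mul_left]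
    exact ENNReal.mul_ne_top ENNReal.ofReal_ne_top hsum.ne
  filter_upwards [ae_lt_top (Measurable.tsum hmeas) hfin] with ω hω
  rw [tendsto_iff_edist_tendsto_0]
  simpa only [edist_comm] using ENNReal.tendsto_atTop_zero_of_tsum_ne_top hω.ne

theorem measure_exists_link_gt_le [IsProbabilityMeasure ν] [IsProbabilityMeasure μ]
    (H : IsMultSample ν ξ X μ ξs Xs A) {F : Set (B → ℝ)} (hF : F ⊆ Lpsi2 (ν.map X))
    {T : ℕ → Set (B → ℝ)} (hT : IsAdmissible (psi2Dist (ν.map X)) F T) {u v : ℝ} (hv : 1 ≤ v)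
    {l : ℕ} (hl : u ≤ 2 ^ l) :
    μ (⋃ j : ℕ, ⋃ p ∈ T (l + j + 1) ×ˢ T (l + j),
      {ω | ω ∈ {ω | ∑ i, ξs i ω ^ 2 ≤ 2 * n * v * A ^ 2} ∧
        ENNReal.ofReal (20 * A * √v * √(8 * 2 ^ (l + j) / n)) * psi2Dist (ν.map X) p.1 p.2 <
          edist (multM ν ξ X ξs Xs p.1 ω) (multM ν ξ X ξs Xs p.2 ω)}) ≤
      ENNReal.ofReal (4 * Real.exp (-u)) := by
  refine (measure_iUnion_le _).trans ?_
  have hj : ∀ j : ℕ, μ (⋃ p ∈ T (l + j + 1) ×ˢ T (l + j),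
      {ω | ω ∈ {ω | ∑ i, ξs i ω ^ 2 ≤ 2 * n * v * A ^ 2} ∧
        ENNReal.ofReal (20 * A * √v * √(8 * 2 ^ (l + j) / n)) * psi2Dist (ν.map X) p.1 p.2 <
          edist (multM ν ξ X ξs Xs p.1 ω) (multM ν ξ X ξs Xs p.2 ω)}) ≤
      ENNReal.ofReal (2 * Real.exp (-u)) * 2⁻¹ ^ j := by
    intro j
    have hcard : (T (l + j + 1) ×ˢ T (l + j)).encard ≤
        ((2 ^ 2 ^ (l + j + 1) * 2 ^ 2 ^ (l + j) : ℕ) : ℕ∞) := by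
      rw [encard_prod]
      push_cast
      exact mul_le_mul' (hT.card_le _) (hT.card_le _)
    refine (measure_biUnion_le_of_encard_le hcard fun p hp =>
      H.measure_inter_edist_multM_gt_le (hF (hT.subset _ hp.1)) (hF (hT.subset _ hp.2))
        (by positivity) hv).trans ?_
    rw [← ENNReal.ofReal_natCast, ← ENNReal.ofReal_mul (by positivity)]
    refine (ENNReal.ofReal_le_ofReal (two_pow_mul_exp_le hl j)).trans (le_of_eq ?_)
    rw [ENNReal.ofReal_mul (by positivity), ENNReal.ofReal_pow (by positivity), one_div,
      ENNReal.ofReal_inv_of_pos two_pos, ENNReal.ofReal_ofNat]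
  refine (ENNReal.tsum_le_tsum hj).trans (le_of_eq ?_)
  rw [ENNReal.tsum_mul_left, ENNReal.tsum_geometric_two,
    show (2 : ℝ≥0∞) = ENNReal.ofReal 2 by simp, ← ENNReal.ofReal_mul (by positivity)]
  congr 1; ring

theorem measure_exists_start_gt_le [IsProbabilityMeasure ν] [IsProbabilityMeasure μ]
    (H : IsMultSample ν ξ X μ ξs Xs A) {F : Set (B → ℝ)} (hF : F ⊆ Lpsi2 (ν.map X))
    {T : ℕ → Set (B → ℝ)} (hT : IsAdmissible (psi2Dist (ν.map X)) F T) {f₀ : B → ℝ}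
    (hf₀ : f₀ ∈ F) {u : ℝ} {l : ℕ} (hl : u ≤ 2 ^ l) :
    μ (⋃ f ∈ T l, {ω | ENNReal.ofReal (10 * A * (√(8 * 2 ^ l / n) + 8 * 2 ^ l / n)) *
        psi2Dist (ν.map X) f f₀ < edist (multM ν ξ X ξs Xs f ω) (multM ν ξ X ξs Xs f₀ ω)}) ≤
      ENNReal.ofReal (2 * Real.exp (-u)) := by
  have hcard : (T l).encard ≤ ((2 ^ 2 ^ l : ℕ) : ℕ∞) := by
    push_cast; exact hT.card_le l
  refine (measure_biUnion_le_of_encard_le hcard fun f hf =>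
    H.measure_edist_multM_gt_le (hF (hT.subset _ hf)) (hF hf₀) (by positivity)).trans ?_
  rw [← ENNReal.ofReal_natCast, ← ENNReal.ofReal_mul (by positivity)]
  refine ENNReal.ofReal_le_ofReal (le_trans ?_ ((two_pow_mul_exp_le hl 0).trans (by simp)))
  simp only [add_zero]
  gcongr
  exact Nat.le_mul_of_pos_left _ (by positivity)

theorem exists_measurableSet_forall_edist_le [IsProbabilityMeasure ν] [IsProbabilityMeasure μ]
    (H : IsMultSample ν ξ X μ ξs Xs A) {F : Set (B → ℝ)} (hF : F ⊆ Lpsi2 (ν.map X))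
    (hsep : IsSeparableOn μ (multM ν ξ X ξs Xs) F)
    {T : ℕ → Set (B → ℝ)} (hT : IsAdmissible (psi2Dist (ν.map X)) F T) {S : ℝ≥0∞} (hS : S < ∞)
    (hsum : ∀ f ∈ F,
      ∑' k : ℕ, (2 : ℝ≥0∞) ^ ((k : ℝ) / 2) * distTo (psi2Dist (ν.map X)) f (T k) ≤ S)
    {f₀ : B → ℝ} (hf₀ : f₀ ∈ F) {u v : ℝ} (hu : 1 ≤ u) (hv : 1 ≤ v) :
    ∃ E : Set Ω, MeasurableSet E ∧
      1 - (6 * Real.exp (-u) + Real.exp (-(n * v))) ≤ μ.real E ∧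
      ∀ ω ∈ E, ∀ f ∈ F, edist (multM ν ξ X ξs Xs f ω) (multM ν ξ X ξs Xs f₀ ω) ≤
        ENNReal.ofReal (60 * A * √v / √n) * (2 * S) +
          ENNReal.ofReal (10 * A * (√(16 * u / n) + 16 * u / n)) *
            (2 * radius (ν.map X) F) := by
  have hP := Measure.isProbabilityMeasure_map (μ := ν) H.meas_X.aemeasurable
  have hA := H.bound.pos
  have hn : (0 : ℝ) < n := by exact_mod_cast H.one_le
  -- The lower bound makes the failure probabilities `exp(-u)`; the upper bound keeps the cost
  -- `8·2^l ≤ 16u` of the starting points of order `u`.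
  obtain ⟨l, hl, hl2⟩ : ∃ l : ℕ, u ≤ 2 ^ l ∧ (2 : ℝ) ^ l ≤ 2 * u := by
    obtain ⟨m, hm, hm2⟩ := exists_nat_pow_near hu one_lt_two
    exact ⟨m + 1, hm2.le, by rw [pow_succ]; linarith⟩
  obtain ⟨D, hDF, hDc, hD⟩ := hsep
  set d := psi2Dist (ν.map X) with hd
  have hTfin : ∀ k, (T k).Finite := fun k =>
    finite_of_encard_le_coe (k := 2 ^ 2 ^ k) (by push_cast; exact hT.card_le k)
  have hterm : ∀ f ∈ F, ∀ k, distTo d f (T k) ≤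
      (2 : ℝ≥0∞) ^ ((k : ℝ) / 2) * distTo d f (T k) := fun f _ k => by
    refine le_mul_of_one_le_left' ?_
    simpa using ENNReal.rpow_le_rpow_of_exponent_le (x := 2) one_le_two
      (show (0 : ℝ) ≤ (k : ℝ) / 2 by positivity)
  -- Admissibility allows empty sets for `k ≥ 1`, but the distance to an empty set is `∞`,
  -- contradicting the finite sum.
  have hTne : ∀ k, (T k).Nonempty := by
    intro k
    by_contra hcon
    rw [not_nonempty_iff_eq_empty] at hcon
    have h1 := (hterm f₀ hf₀ k).trans ((ENNReal.le_tsum k).trans (hsum f₀ hf₀))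
    simp only [hcon, distTo, mem_empty_iff_false, iInf_false, iInf_top, top_le_iff] at h1
    exact hS.ne h1
  choose π hπT hπd using fun (f : B → ℝ) (k : ℕ) =>
    exists_mem_eq_distTo (d := d) (hTfin k) (hTne k) f
  have hπF : ∀ f k, π f k ∈ F := fun f k => hT.subset k (hπT f k)
  have hlim : ∀ᵐ ω ∂μ, ∀ g ∈ D, Tendsto (fun k => multM ν ξ X ξs Xs (π g k) ω) atTop
      (𝓝 (multM ν ξ X ξs Xs g ω)) := by
    rw [ae_ball_iff hDc]
    intro g hg
    refine H.ae_tendsto_multM (hF (hDF hg)) (fun k => hF (hπF g k)) (lt_of_le_of_lt ?_ hS)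
    simp only [← hd, hπd]
    exact (ENNReal.tsum_le_tsum (hterm g (hDF hg))).trans (hsum g (hDF hg))
  set G : Set Ω := {ω | ∑ i, ξs i ω ^ 2 ≤ 2 * n * v * A ^ 2} with hG
  set Z₁ : Set Ω := ⋃ j : ℕ, ⋃ p ∈ T (l + j + 1) ×ˢ T (l + j), {ω | ω ∈ G ∧
        ENNReal.ofReal (20 * A * √v * √(8 * 2 ^ (l + j) / n)) * d p.1 p.2 <
          edist (multM ν ξ X ξs Xs p.1 ω) (multM ν ξ X ξs Xs p.2 ω)} with hZ₁
  set Z₂ : Set Ω := ⋃ f ∈ T l,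
    {ω | ENNReal.ofReal (10 * A * (√(8 * 2 ^ l / n) + 8 * 2 ^ l / n)) *
        d f f₀ < edist (multM ν ξ X ξs Xs f ω) (multM ν ξ X ξs Xs f₀ ω)} with hZ₂
  set Z₃ : Set Ω := {ω | (∀ g ∈ D, Tendsto (fun k => multM ν ξ X ξs Xs (π g k) ω) atTop
      (𝓝 (multM ν ξ X ξs Xs g ω))) ∧ ∀ f ∈ F, multM ν ξ X ξs Xs f ω ∈
        closure ((fun g => multM ν ξ X ξs Xs g ω) '' D)}ᶜ with hZ₃
  have h3 : μ Z₃ = 0 := hlim.and hD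
  have hμ : μ (Gᶜ ∪ Z₁ ∪ Z₂ ∪ Z₃)ᶜᶜ ≤
      ENNReal.ofReal (6 * Real.exp (-u) + Real.exp (-(n * v))) := by
    rw [compl_compl]
    calc μ (Gᶜ ∪ Z₁ ∪ Z₂ ∪ Z₃) ≤ μ Gᶜ + μ Z₁ + μ Z₂ + μ Z₃ :=
          (measure_union_le _ _).trans (add_le_add_left ((measure_union_le _ _).trans
            (add_le_add_left (measure_union_le _ _) _)) _)
      _ ≤ ENNReal.ofReal (Real.exp (-(n * v))) + ENNReal.ofReal (4 * Real.exp (-u)) +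
            ENNReal.ofReal (2 * Real.exp (-u)) + 0 :=
          add_le_add (add_le_add (add_le_add (H.measure_sum_sq_gt_le hv)
            (H.measure_exists_link_gt_le hF hT hv hl))
            (H.measure_exists_start_gt_le hF hT hf₀ hl)) h3.le
      _ = _ := by
          rw [add_zero, ← ENNReal.ofReal_add (by positivity) (by positivity),
            ← ENNReal.ofReal_add (by positivity) (by positivity)]
          congr 1; ring
  obtain ⟨E, hE, hEm, hEμ⟩ := exists_measurableSet_of_measure_compl_le (by positivity) hμ
  refine ⟨E, hEm, hEμ, fun ω hωE => ?_⟩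
  have hω := hE hωE
  simp only [compl_union, mem_inter_iff, compl_compl, hZ₃] at hω
  obtain ⟨⟨⟨hωG, hω₁⟩, hω₂⟩, hωlim, hωcl⟩ := hω
  simp only [hZ₁, hZ₂, mem_compl_iff, mem_iUnion, not_exists, mem_ofPred_eq, not_and, not_lt]
    at hω₁ hω₂
  have hDbound : ∀ g ∈ D, edist (multM ν ξ X ξs Xs g ω) (multM ν ξ X ξs Xs f₀ ω) ≤
      ENNReal.ofReal (60 * A * √v / √n) * (2 * S) +
        ENNReal.ofReal (10 * A * (√(16 * u / n) + 16 * u / n)) * (2 * radius (ν.map X) F) := by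
    intro g hg
    refine (edist_le_of_chain (L := ENNReal.ofReal (60 * A * √v / √n)) (l := l)
      (δ := fun k => distTo d g (T k))
      (x := ENNReal.ofReal (10 * A * (√(16 * u / n) + 16 * u / n)) * (2 * radius (ν.map X) F))
      (hωlim g hg) ?_ ?_).trans ?_
    · refine (hω₂ _ (hπT g l)).trans ?_
      have h16 : (8 : ℝ) * 2 ^ l ≤ 16 * u := by linarith
      gcongr
      exact psi2Dist_le_two_mul_radius hF (hπF g l) hf₀
    · intro k hk
      obtain ⟨j, rfl⟩ := Nat.exists_eq_add_of_le hk
      refine (hω₁ j (π g (l + j + 1), π g (l + j)) ⟨hπT _ _, hπT _ _⟩ hωG).trans ?_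
      have htri : d (π g (l + j + 1)) (π g (l + j)) ≤
          distTo d g (T (l + j + 1)) + distTo d g (T (l + j)) := by
        rw [← hπd, ← hπd]
        refine (psi2Dist_triangle (hF (hπF g _)).1 (hF (hDF hg)).1 (hF (hπF g _)).1).trans ?_
        rw [psi2Dist_comm]
      -- The constant `60` is `20 · 3`, with `√8 ≤ 3`.
      have hcoef : ENNReal.ofReal (20 * A * √v * √(8 * 2 ^ (l + j) / n)) ≤
          ENNReal.ofReal (60 * A * √v / √n) * (2 : ℝ≥0∞) ^ (((l + j : ℕ) : ℝ) / 2) := by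
        rw [show (2 : ℝ≥0∞) = ENNReal.ofReal 2 by simp,
          ENNReal.ofReal_rpow_of_pos two_pos, ← ENNReal.ofReal_mul (by positivity)]
        refine ENNReal.ofReal_le_ofReal ?_
        have hr : (2 : ℝ) ^ (((l + j : ℕ) : ℝ) / 2) = √(2 ^ (l + j)) := by
          rw [Real.sqrt_eq_rpow, ← Real.rpow_natCast 2 (l + j),
            ← Real.rpow_mul zero_le_two]
          congr 1; ring
        have h8 : √(8 : ℝ) ≤ 3 := Real.sqrt_le_iff.2 (by norm_num)
        rw [hr, Real.sqrt_div (by positivity), Real.sqrt_mul (by norm_num)]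
        calc 20 * A * √v * (√8 * √(2 ^ (l + j)) / √n) ≤
              20 * A * √v * (3 * √(2 ^ (l + j)) / √n) := by gcongr
          _ = _ := by ring
      rw [← mul_assoc]
      exact mul_le_mul' hcoef htri
    · gcongr
      exact hsum g (hDF hg)
  intro f hf
  -- The bound is a closed condition on the value of the process, so it passes from `D` to `F`.
  have hclosed : IsClosed {y : ℝ | edist y (multM ν ξ X ξs Xs f₀ ω) ≤
      ENNReal.ofReal (60 * A * √v / √n) * (2 * S) +
        ENNReal.ofReal (10 * A * (√(16 * u / n) + 16 * u / n)) * (2 * radius (ν.map X) F)} :=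
    isClosed_le (by fun_prop) continuous_const
  refine hclosed.closure_subset_iff.2 ?_ (hωcl f hf)
  rintro _ ⟨g, hg, rfl⟩
  exact hDbound g hg

end IsMultSample

/-- If the multipliers vanish in `ψ₂`-norm then almost surely the multiplier process is zero. -/
theorem ae_multM_eq_zero {Ω₀ Ω B : Type*} [MeasurableSpace Ω₀] [MeasurableSpace Ω]
    {ν : Measure Ω₀} [IsProbabilityMeasure ν] {μ : Measure Ω} {ξ : Ω₀ → ℝ} {X : Ω₀ → B} {n : ℕ}
    {ξs : Fin n → Ω → ℝ} {Xs : Fin n → Ω → B} (hξ : Measurable ξ) (h0 : psi2Norm ν ξ = 0)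
    (hid : ∀ i, IdentDistrib (ξs i) ξ μ ν) :
    ∀ᵐ ω ∂μ, ∀ f : B → ℝ, multM ν ξ X ξs Xs f ω = 0 := by
  have hξ0 : ∀ᵐ ω ∂ν, ξ ω = 0 := by
    have hi : ∀ K : ℝ, 0 < K → Integrable (fun ω => ξ ω * ξ ω) ν ∧
        ∫ ω, |ξ ω * ξ ω| ∂ν ≤ K * K := by
      intro K hK
      have hb := hasPsi2Bound_of_psi2Norm_lt hξ (K := K) (by rw [h0]; simpa using hK)
      exact ⟨(hb.mul hb).integrable_self, (hb.mul hb).integral_abs_le⟩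
    have hz : ∫ ω, |ξ ω * ξ ω| ∂ν ≤ 0 := by
      refine le_of_forall_pos_le_add fun ε hε => ?_
      rw [zero_add]
      simpa [Real.mul_self_sqrt hε.le] using (hi (√ε) (Real.sqrt_pos.2 hε)).2
    have hz' := (integral_eq_zero_iff_of_nonneg (fun ω => abs_nonneg _)
      (hi 1 one_pos).1.abs).1 (le_antisymm hz (integral_nonneg fun ω => abs_nonneg _))
    filter_upwards [hz'] with ω hω
    simpa using hω
  have hξs0 : ∀ᵐ ω ∂μ, ∀ i, ξs i ω = 0 :=
    ae_all_iff.2 fun i => (hid i).symm.ae_snd (p := fun x => x = 0)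
      (measurableSet_singleton 0) hξ0
  filter_upwards [hξs0] with ω hω f
  have hm : ∫ ω₀, ξ ω₀ * f (X ω₀) ∂ν = 0 := by
    refine integral_eq_zero_of_ae ?_
    filter_upwards [hξ0] with ω₀ h
    simp [h]
  simp [multM, hω, hm]

end MultProc

/-! ### The theorem: degenerate cases and constants. -/

theorem mainTheorem6 :
    ∃ c : ℝ, 0 < c ∧ ∃ C : ℝ, 0 < C ∧
      ∀ (B : Type*) [MeasurableSpace B] (P : Measure B) [IsProbabilityMeasure P]
        -- the random pair `(ξ, X)`, where `X` has law `P`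
        (Ω₀ : Type*) [MeasurableSpace Ω₀] (ν : Measure Ω₀) [IsProbabilityMeasure ν]
        (ξ : Ω₀ → ℝ) (X : Ω₀ → B) (_ : Measurable ξ) (_ : Measurable X) (_ : ν.map X = P)
        (_ : MultProc.psi2Norm ν ξ < ∞)
        -- the iid sample of size `n`
        (Ω : Type*) [MeasurableSpace Ω] (μ : Measure Ω) [IsProbabilityMeasure μ]
        (n : ℕ) (_ : 1 ≤ n) (ξs : Fin n → Ω → ℝ) (Xs : Fin n → Ω → B)
        (_ : ∀ i, Measurable (ξs i)) (_ : ∀ i, Measurable (Xs i))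
        (_ : iIndepFun (fun i ω => (ξs i ω, Xs i ω)) μ)
        (_ : ∀ i, IdentDistrib (fun ω => (ξs i ω, Xs i ω)) (fun ω₀ => (ξ ω₀, X ω₀)) μ ν)
        -- the subgaussian class
        (F : Set (B → ℝ)) (_ : F ⊆ MultProc.Lpsi2 P)
        (_ : MultProc.IsSeparableOn μ (MultProc.multM ν ξ X ξs Xs) F)
        (f₀ : B → ℝ) (_ : f₀ ∈ F) (u v : ℝ) (_ : 1 ≤ u) (_ : 1 ≤ v),
        ∃ E : Set Ω, MeasurableSet E ∧
          1 - c * Real.exp (-u / 4) - c * Real.exp (-(n * v)) ≤ μ.real E ∧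
          ∀ ω ∈ E,
            ⨆ f ∈ F, ENNReal.ofReal |MultProc.multM ν ξ X ξs Xs f ω
                - MultProc.multM ν ξ X ξs Xs f₀ ω| ≤
              ENNReal.ofReal C *
                (ENNReal.ofReal ((√v + 1) / √n) * MultProc.psi2Norm ν ξ *
                    MultProc.gamma2 (MultProc.psi2Dist P) F +
                  ENNReal.ofReal (√(2 * u / n) + u / n + √(u * v / n)) * MultProc.psi2Norm ν ξ *
                    MultProc.radius P F) := by
  -- `6 = 4 + 2` counts links and starting points. `640 = 10·2·16·2` comes from the radius term,
  -- with multiplier scale `2‖ξ‖` and diameter at most twice the radius; the `γ₂` term needs only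
  -- `480`.
  refine ⟨6, by norm_num, 640, by norm_num, ?_⟩
  intro B _ P hPprob Ω₀ _ ν _ ξ X hξ hX hP hξfin Ω _ μ _ n hn ξs Xs hξs hXs hind hid F hF hsep f₀ hf₀
    u v hu hv
  subst hP
  have hprob : 1 - 6 * Real.exp (-u / 4) - 6 * Real.exp (-(n * v)) ≤
      1 - (6 * Real.exp (-u) + Real.exp (-(n * v))) := by
    have : Real.exp (-u) ≤ Real.exp (-u / 4) := Real.exp_le_exp.2 (by linarith)
    linarith [Real.exp_pos (-(n * v))]
  have hprob1 : 1 - 6 * Real.exp (-u / 4) - 6 * Real.exp (-(n * v)) ≤ 1 := by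
    linarith [Real.exp_pos (-(n * v)), Real.exp_pos (-u / 4)]
  have hn0 : (0 : ℝ) < n := by exact_mod_cast hn
  -- When `‖ξ‖ = 0` the right side is `0` even if `γ₂` or the radius is infinite, so the process
  -- itself must vanish. Otherwise `2‖ξ‖` is a scale strictly above the norm.
  rcases eq_or_ne (MultProc.psi2Norm ν ξ) 0 with h0 | h0
  · have hae := MultProc.ae_multM_eq_zero (X := X) (Xs := Xs) hξ h0
      fun i => (hid i).comp (u := Prod.fst) measurable_fst
    have hc : μ {ω | ∀ f, MultProc.multM ν ξ X ξs Xs f ω = 0}ᶜ ≤ ENNReal.ofReal 0 := by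
      rw [ENNReal.ofReal_zero]; exact le_of_eq hae
    obtain ⟨E, hE, hEm, hEμ⟩ := MultProc.exists_measurableSet_of_measure_compl_le le_rfl hc
    refine ⟨E, hEm, hprob1.trans (by simpa using hEμ), fun ω hω => iSup₂_le fun f _ => ?_⟩
    have h := hE hω
    rw [h f, h f₀]
    simp
  have hvn : 0 < (√v + 1) / √n := by positivity
  rcases eq_or_ne (MultProc.gamma2 (MultProc.psi2Dist (ν.map X)) F) ∞ with hγ | hγ
  · refine ⟨univ, MeasurableSet.univ, by simpa using hprob1, fun ω _ => le_top.trans_eq ?_⟩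
    rw [hγ, ENNReal.mul_top (mul_ne_zero (by simpa using hvn) h0), top_add,
      ENNReal.mul_top (by simp)]
  have H : MultProc.IsMultSample ν ξ X μ ξs Xs (2 * (MultProc.psi2Norm ν ξ).toReal) := by
    refine ⟨hn, hX, hξs, hXs, hind, hid, MultProc.hasPsi2Bound_of_psi2Norm_lt hξ ?_⟩
    rw [ENNReal.lt_ofReal_iff_toReal_lt hξfin.ne]
    linarith [ENNReal.toReal_pos h0 hξfin.ne]
  obtain ⟨T, hT, hsum⟩ := MultProc.exists_isAdmissible_tsum_le hf₀
    (MultProc.psi2Dist_comm (μ := ν.map X)) (fun f hf g hg h hh =>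
      MultProc.psi2Dist_triangle (hF hf).1 (hF hg).1 (hF hh).1) (lt_top_iff_ne_top.2 hγ)
  obtain ⟨E, hEm, hEμ, hE⟩ := H.exists_measurableSet_forall_edist_le hF hsep hT
    (ENNReal.mul_lt_top (by simp) (lt_top_iff_ne_top.2 hγ)) hsum hf₀ hu hv
  refine ⟨E, hEm, hprob.trans hEμ, fun ω hω => iSup₂_le fun f hf => ?_⟩
  rw [← Real.dist_eq, ← edist_dist]
  refine (hE ω hω f hf).trans ?_
  set N := (MultProc.psi2Norm ν ξ).toReal with hN
  have hN0 : 0 ≤ N := ENNReal.toReal_nonneg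
  rw [← ENNReal.ofReal_toReal hξfin.ne, ← hN, mul_add (ENNReal.ofReal 640)]
  set γ := MultProc.gamma2 (MultProc.psi2Dist (ν.map X)) F
  set r := MultProc.radius (ν.map X) F
  apply add_le_add
  · have h1 : 60 * (2 * N) * √v / √n * 2 * 2 ≤ 640 * ((√v + 1) / √n) * N := by
      calc 60 * (2 * N) * √v / √n * 2 * 2 = 480 * (√v / √n) * N := by ring
        _ ≤ 640 * ((√v + 1) / √n) * N := by gcongr <;> linarith
    calc ENNReal.ofReal (60 * (2 * N) * √v / √n) * (2 * (2 * γ))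
        = ENNReal.ofReal (60 * (2 * N) * √v / √n * 2 * 2) * γ := by
          rw [ENNReal.ofReal_mul (p := _ * 2) (by positivity),
            ENNReal.ofReal_mul (q := 2) (by positivity), ENNReal.ofReal_ofNat]
          ring
      _ ≤ ENNReal.ofReal (640 * ((√v + 1) / √n) * N) * γ :=
          mul_le_mul_left (ENNReal.ofReal_le_ofReal h1) γ
      _ = _ := by
          rw [ENNReal.ofReal_mul (by positivity), ENNReal.ofReal_mul (by positivity)]
          ring
  · have h1 : √(16 * u / n) ≤ 4 * √(2 * u / n) := by
      rw [show (4 : ℝ) = √16 by rw [show (16 : ℝ) = 4 ^ 2 by norm_num]; simp,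
        ← Real.sqrt_mul (by norm_num)]
      refine Real.sqrt_le_sqrt ?_
      rw [← mul_div_assoc]
      gcongr
      linarith
    have h2 : 0 ≤ √(2 * u / n) := Real.sqrt_nonneg _
    have h3 : 0 ≤ √(u * v / n) := Real.sqrt_nonneg _
    have h4 : 0 ≤ u / n := by positivity
    have h5 : 10 * (2 * N) * (√(16 * u / n) + 16 * u / n) * 2 ≤
        640 * (√(2 * u / n) + u / n + √(u * v / n)) * N := by
      calc 10 * (2 * N) * (√(16 * u / n) + 16 * u / n) * 2
          = (40 * √(16 * u / n) + 640 * (u / n)) * N := by ring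
        _ ≤ _ := mul_le_mul_of_nonneg_right (by linarith) hN0
    calc ENNReal.ofReal (10 * (2 * N) * (√(16 * u / n) + 16 * u / n)) * (2 * r)
        = ENNReal.ofReal (10 * (2 * N) * (√(16 * u / n) + 16 * u / n) * 2) * r := by
          rw [ENNReal.ofReal_mul (q := 2) (by positivity), ENNReal.ofReal_ofNat]
          ring
      _ ≤ ENNReal.ofReal (640 * (√(2 * u / n) + u / n + √(u * v / n)) * N) * r :=
          mul_le_mul_left (ENNReal.ofReal_le_ofReal h5) r
      _ = _ := by
          rw [ENNReal.ofReal_mul (by positivity), ENNReal.ofReal_mul (by positivity)]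
          ring
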